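/- Let $\Omega\subset\mathbb C^n$ be a bounded domain and let $\mu$ be a non-negative Borel measure in $\Omega$. For an open set $D\subset\Omega$ and a non-negative Borel measure $\nu$ in $D$, a solution of the Dirichlet problem $\mathcal M(D,\nu)$ is a plurisubharmonic function $u$ in $D$ that is Hölder continuous on $\overline D$ and satisfies $(dd^c u)^n=\nu$ in $D$ and $u=0$ on $\partial D$, where $(dd^c u)^n$ is the complex Monge–Ampère measure of $u$. A function is called a sub-solution of $\mathcal M(D,\mu)$ if it is a solution of $\mathcal M(D,\nu)$ for some measure $\nu\ge\mu$ in $D$; it is called negative if it is $<0$ in $D$. Suppose that for every $z\in\overline\Omega$ there is a radius $r_z>0$ such that $\mathcal M(\Omega\cap\mathbb B(z,r_z),\mu)$ has a negative sub-solution, where $\mathbb B(z,r_z)$ is the open Euclidean ball. Then there is a Hölder continuous function $u$ on $\overline\Omega$ that is plurisubharmonic in $\Omega$ and satisfies $$(dd^c u)^n\ge\mu\quad\text{on }\Omega .$$ -/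

import Mathlib

open MeasureTheory Filter Topology Set
open scoped NNReal ContDiff

noncomputable section

/-- The space `ℂⁿ` with its Hermitian norm and its Borel `σ`-algebra. -/
abbrev Cn (n : ℕ) : Type := EuclideanSpace ℂ (Fin n)

/-- The `j`-th vector of the standard basis of `ℂⁿ`. -/
def stdVec {n : ℕ} (j : Fin n) : Cn n := EuclideanSpace.single j (1 : ℂ)

/-- The Wirtinger derivative `∂f/∂z_j = (∂f/∂x_j - i ∂f/∂y_j) / 2`. -/
def wirtinger {n : ℕ} (j : Fin n) (f : Cn n → ℂ) (p : Cn n) : ℂ :=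
  (1 / 2 : ℂ) *
    (fderiv ℝ f p (stdVec j) - Complex.I * fderiv ℝ f p (Complex.I • stdVec j))

/-- The conjugate Wirtinger derivative `∂f/∂z̄_j = (∂f/∂x_j + i ∂f/∂y_j) / 2`. -/
def wirtingerBar {n : ℕ} (j : Fin n) (f : Cn n → ℂ) (p : Cn n) : ℂ :=
  (1 / 2 : ℂ) *
    (fderiv ℝ f p (stdVec j) + Complex.I * fderiv ℝ f p (Complex.I • stdVec j))

/-- The complex Hessian `(∂²u/∂z_j∂z̄_k)` of a real function. -/
def complexHessian {n : ℕ} (u : Cn n → ℝ) (p : Cn n) : Matrix (Fin n) (Fin n) ℂ :=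
  Matrix.of fun j k => wirtinger j (wirtingerBar k fun w => (u w : ℂ)) p

/-- For a function `u` of class `C²`, with `d = ∂ + ∂̄` and `d^c = i(∂̄ - ∂)`, the form `(dd^c u)ⁿ` is
`4ⁿ n! det(∂²u/∂z_j∂z̄_k)` times the Lebesgue volume form; this is the coefficient.
(The determinant is real, since the Hessian is Hermitian.) -/
def mongeAmpereDensity {n : ℕ} (u : Cn n → ℝ) (p : Cn n) : ℝ :=
  (4 : ℝ) ^ n * (n.factorial : ℝ) * (complexHessian u p).det.re

/-- A finite-valued function is plurisubharmonic in the open set `D`: it is upper semicontinuous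
and satisfies the sub-mean value inequality on every closed disc `{a + ζ b : |ζ| ≤ 1}` contained
in `D`. (A finite value at the centre forces the mean value to be finite, so integrability on the
circle is part of the inequality.) -/
structure IsPSH {n : ℕ} (D : Set (Cn n)) (u : Cn n → ℝ) : Prop where
  usc : UpperSemicontinuousOn u D
  subMean : ∀ a b : Cn n, (∀ ζ : ℂ, ‖ζ‖ ≤ 1 → a + ζ • b ∈ D) →
    CircleIntegrable (fun ζ : ℂ => u (a + ζ • b)) 0 1 ∧
      u a ≤ Real.circleAverage (fun ζ : ℂ => u (a + ζ • b)) 0 1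

/-- `u` is Hölder continuous on `S`, with some exponent in `(0, 1]`. -/
def IsHolderOn {n : ℕ} (S : Set (Cn n)) (u : Cn n → ℝ) : Prop :=
  ∃ C α : ℝ≥0, 0 < α ∧ α ≤ 1 ∧ HolderOnWith C α u S

/-- `(dd^c u)ⁿ = ν` in the open set `D`, for a plurisubharmonic function `u` in `D`: the measure
`ν` is finite on the compact subsets of `D`, and for every open `U ⊆ D` and every sequence of
smooth plurisubharmonic functions `v_i` in `U` that decreases to `u` in `U`, the measures
`(dd^c v_i)ⁿ` converge to `ν` weakly in `U`. (On relatively compact open subsets of `D`, standard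
mollifications of `u` are such sequences, so `ν` is unique in `D`.) Only the restriction of `ν`
to `D` matters. -/
structure IsMongeAmpere {n : ℕ} (D : Set (Cn n)) (u : Cn n → ℝ) (ν : Measure (Cn n)) :
    Prop where
  finite_on_compacts : ∀ K : Set (Cn n), IsCompact K → K ⊆ D → ν K < ⊤
  weak_limit : ∀ U : Set (Cn n), IsOpen U → U ⊆ D → ∀ v : ℕ → Cn n → ℝ,
    (∀ i, IsPSH U (v i)) → (∀ i, ContDiffOn ℝ ∞ (v i) U) →
    (∀ z ∈ U, Antitone fun i => v i z) →
    (∀ z ∈ U, Tendsto (fun i => v i z) atTop (𝓝 (u z))) →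
    ∀ f : Cn n → ℝ, Continuous f → HasCompactSupport f → tsupport f ⊆ U →
      Tendsto (fun i => ∫ z, f z * mongeAmpereDensity (v i) z) atTop (𝓝 (∫ z, f z ∂ν))

/-- `u` is a solution of the Dirichlet problem `M(D, ν)`: it is plurisubharmonic in `D`, Hölder
continuous on the closure of `D`, with `(dd^c u)ⁿ = ν` in `D` and `u = 0` on the boundary. -/
structure IsSolution {n : ℕ} (D : Set (Cn n)) (ν : Measure (Cn n)) (u : Cn n → ℝ) :
    Prop where
  psh : IsPSH D u
  holder : IsHolderOn (closure D) u
  mongeAmpere : IsMongeAmpere D u ν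
  boundary : ∀ z ∈ frontier D, u z = 0

/-- `u` is a sub-solution of `M(D, μ)`: a solution of `M(D, ν)` for some measure `ν ≥ μ` on `D`. -/
def IsSubsolution {n : ℕ} (D : Set (Cn n)) (μ : Measure (Cn n)) (u : Cn n → ℝ) : Prop :=
  ∃ ν : Measure (Cn n), μ.restrict D ≤ ν.restrict D ∧ IsSolution D ν u

/-- `(dd^c u)ⁿ ≥ μ` on `D`: the Monge-Ampère measure of `u` in `D` exists and dominates `μ`. -/
def MongeAmpereGE {n : ℕ} (D : Set (Cn n)) (u : Cn n → ℝ) (μ : Measure (Cn n)) : Prop :=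
  ∃ ν : Measure (Cn n), IsMongeAmpere D u ν ∧ μ.restrict D ≤ ν.restrict D

end

/-!
Near each point `z` of the closure, the local function `w` is replaced by the maximum of `w` and a
quadratic function `A * (dist x z ^ 2 - s)`. A suitable choice of `A` and `s` makes the quadratic
smaller than `w` close to `z` and larger than `w` near the boundary of the ball, so that the maximum
extends by the quadratic to a Hölder continuous plurisubharmonic function on the whole domain which
still equals `w` close to `z`. The sum of these extensions over a finite cover is the solution: each
summand dominates `μ` where it agrees with its `w`, and adding plurisubharmonic functions only
increases the Monge–Ampère measure, because `det A ≤ det (A + B)` for positive semidefinite `A` and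
`B`.

The superadditivity passes from smooth to continuous functions by mollification. That the
Monge–Ampère measures of mollifications converge is the Bedford–Taylor theorem: by Piola's identity
one factor of `dd^c (u - v)` at a time can be moved onto the test function, and the remaining mixed
determinants are bounded in mass by the Chern–Levine–Nirenberg inequality.
-/

/-! ### Determinants, adjugates and derivations -/

section Derivations

variable {S R ι : Type*} [CommRing S] [CommRing R] [Algebra S R] [Fintype ι] [DecidableEq ι]

omit [Fintype ι] in
theorem derivation_prod (D : Derivation S R R) (s : Finset ι) (a : ι → R) :
    D (∏ i ∈ s, a i) = ∑ i ∈ s, ∏ j ∈ s, Function.update a i (D (a i)) j := by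
  induction s using Finset.induction_on with
  | empty => simp
  | insert i s hi ih =>
    have update_head : ∏ j ∈ s, Function.update a i (D (a i)) j = ∏ j ∈ s, a j :=
      Finset.prod_update_of_notMem hi ..
    have update_tail : ∑ k ∈ s, ∏ j ∈ insert i s, Function.update a k (D (a k)) j =
        a i * ∑ k ∈ s, ∏ j ∈ s, Function.update a k (D (a k)) j := by
      rw [Finset.mul_sum]
      refine Finset.sum_congr rfl fun k hk => ?_
      rw [Finset.prod_insert hi, Function.update_of_ne (ne_of_mem_of_not_mem hk hi).symm]
    rw [Finset.prod_insert hi, D.leibniz, ih, Finset.sum_insert hi, Finset.prod_insert hi,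
      update_head, update_tail, Function.update_self, smul_eq_mul, smul_eq_mul]
    ring

theorem derivation_det_eq_sum_updateCol (D : Derivation S R R) (M : Matrix ι ι R) :
    D M.det = ∑ j, (M.updateCol j fun i => D (M i j)).det := by
  simp only [Matrix.det_apply, map_sum]
  rw [Finset.sum_comm]
  refine Finset.sum_congr rfl fun σ _ => ?_
  rw [← Finset.smul_sum]
  have leibniz : D (∏ i, M (σ i) i) =
      ∑ j, ∏ i, (M.updateCol j fun i => D (M i j)) (σ i) i := by
    rw [derivation_prod]
    refine Finset.sum_congr rfl fun j _ => Finset.prod_congr rfl fun i _ => ?_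
    rcases eq_or_ne i j with rfl | h
    · simp
    · simp [h]
  rw [← leibniz, Units.smul_def, Units.smul_def]
  exact map_zsmul D _ _

theorem derivation_det (D : Derivation S R R) (M : Matrix ι ι R) :
    D M.det = (M.adjugate * M.map D).trace := by
  rw [derivation_det_eq_sum_updateCol]
  refine Finset.sum_congr rfl fun j _ => ?_
  rw [← Matrix.cramer_apply, Matrix.cramer_eq_adjugate_mulVec]
  rfl

theorem adjugate_apply_eq_det_updateCol (A : Matrix ι ι R) (i j : ι) :
    A.adjugate i j = (A.updateCol i (Pi.single j 1)).det := by
  rw [← Matrix.cramer_apply, Matrix.cramer_eq_adjugate_mulVec, Matrix.mulVec_single_one]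
  rfl

omit [Fintype ι] [CommRing R] in
theorem updateCol_updateCol_submatrix_swap (A : Matrix ι ι R) {i j : ι} (hij : i ≠ j)
    (b c : ι → R) :
    ((A.updateCol i b).updateCol j c).submatrix id (Equiv.swap i j) =
      (A.updateCol i c).updateCol j b := by
  ext k m
  rcases eq_or_ne m i with rfl | hmi
  · simp [hij]
  rcases eq_or_ne m j with rfl | hmj
  · simp [hij]
  · simp [hmi, hmj, Equiv.swap_apply_of_ne_of_ne]

theorem det_updateCol_updateCol_swap (A : Matrix ι ι R) {i j : ι} (hij : i ≠ j) (b c : ι → R) :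
    ((A.updateCol i c).updateCol j b).det = -((A.updateCol i b).updateCol j c).det := by
  rw [← updateCol_updateCol_submatrix_swap A hij, Matrix.det_permute', Equiv.Perm.sign_swap hij]
  simp

omit [DecidableEq ι] in
theorem sum_sum_eq_zero_of_antisymm {M : Type*} [AddCommGroup M] {T : ι → ι → M}
    (hdiag : ∀ i, T i i = 0) (hanti : ∀ i j, i ≠ j → T i j = -T j i) :
    ∑ i, ∑ j, T i j = 0 := by
  rw [← Fintype.sum_prod_type']
  refine Finset.sum_involution (fun p _ => p.swap) (fun p _ => ?_) (fun p _ hp hswap => hp ?_)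
    (fun _ _ => Finset.mem_univ _) (fun p _ => p.swap_swap)
  · rcases eq_or_ne p.1 p.2 with h | h
    · simp [h, hdiag]
    · simp [hanti _ _ h]
  · rw [← (Prod.ext_iff.1 hswap).1]
    exact hdiag _

/- Piola's identity. The derivative of `adj J` brings second derivatives `D j (D i (g k))` into
column `i` of a minor; exchanging the columns `i` and `j` shows that they cancel in pairs. -/
theorem sum_derivation_adjugate_jacobian (D : ι → Derivation S R R)
    (hD : ∀ i j f, D i (D j f) = D j (D i f)) (g : ι → R) (l : ι) :
    ∑ j, D j ((Matrix.of fun k m => D m (g k)).adjugate j l) = 0 := by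
  set J : Matrix ι ι R := Matrix.of fun k m => D m (g k)
  let T : ι → ι → R := fun j i => if i = j then 0 else
    ((J.updateCol j (Pi.single l 1)).updateCol i fun k => D j (D i (g k))).det
  have expand : ∀ j, D j (J.adjugate j l) = ∑ i, T j i := fun j => by
    rw [adjugate_apply_eq_det_updateCol, derivation_det_eq_sum_updateCol]
    refine Finset.sum_congr rfl fun i _ => ?_
    rcases eq_or_ne i j with rfl | hij
    · simp only [T, if_true]
      refine Matrix.det_eq_zero_of_column_eq_zero i fun k => ?_
      rcases eq_or_ne k l with rfl | hkl
      · simp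
      · simp [hkl]
    · simp only [T, if_neg hij]
      congr 2
      funext k
      simp [Matrix.updateCol_ne hij, J]
  simp only [expand]
  refine sum_sum_eq_zero_of_antisymm (fun i => if_pos rfl) fun i j hij => ?_
  simp only [T, if_neg hij, if_neg hij.symm]
  rw [Matrix.updateCol_comm _ hij, det_updateCol_updateCol_swap _ hij.symm]
  simp only [hD i j]

/-- The mixed Hessian `(D_j E_l v)` of an element of a ring with respect to two families of
derivations; for the Wirtinger derivatives this is the complex Hessian. -/
def mixedHessian (D E : ι → Derivation S R R) (v : R) : Matrix ι ι R :=
  Matrix.of fun j l => D j (E l v)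

omit [Fintype ι] [DecidableEq ι] in
theorem mixedHessian_transpose {D E : ι → Derivation S R R}
    (hDE : ∀ i j f, D i (E j f) = E j (D i f)) (v : R) :
    (mixedHessian D E v).transpose = mixedHessian E D v := by
  ext j l
  exact hDE _ _ _

theorem sum_derivation_adjugate_mixedHessian {D : ι → Derivation S R R}
    (hD : ∀ i j f, D i (D j f) = D j (D i f)) (E : ι → Derivation S R R) (v : R) (l : ι) :
    ∑ j, D j ((mixedHessian D E v).adjugate l j) = 0 := by
  rw [← sum_derivation_adjugate_jacobian D hD (fun k => E k v) l]
  refine Finset.sum_congr rfl fun j _ => ?_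
  rw [← Matrix.transpose_apply (Matrix.adjugate _), Matrix.adjugate_transpose]
  rfl

omit [DecidableEq ι] in
theorem sum_derivation_mul_eq_add (D E : ι → Derivation S R R) {P : Matrix ι ι R}
    (hP : ∀ l, ∑ j, D j (P l j) = 0) (φ χ : R) :
    ∑ j, D j (χ * ∑ l, P l j * E l φ) =
      χ * (P * mixedHessian D E φ).trace + ∑ j, ∑ l, P l j * E l φ * D j χ := by
  have divergence_free : ∑ j, ∑ l, χ * (E l φ * D j (P l j)) = 0 := by
    rw [Finset.sum_comm]
    simp only [← Finset.mul_sum, hP, mul_zero, Finset.sum_const_zero]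
  have trace_eq : (P * mixedHessian D E φ).trace = ∑ j, ∑ l, P l j * D j (E l φ) := by
    rw [Finset.sum_comm]
    rfl
  simp only [trace_eq, Derivation.leibniz, map_sum, smul_eq_mul, Finset.sum_add_distrib, mul_add,
    Finset.mul_sum, divergence_free, add_zero]

theorem mul_trace_adjugate_sub_mul_trace_adjugate {D E : ι → Derivation S R R}
    (hD : ∀ i j f, D i (D j f) = D j (D i f)) (hE : ∀ i j f, E i (E j f) = E j (E i f))
    (hDE : ∀ i j f, D i (E j f) = E j (D i f)) (v φ χ : R) :
    χ * ((mixedHessian D E v).adjugate * mixedHessian D E φ).trace -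
        φ * ((mixedHessian D E v).adjugate * mixedHessian D E χ).trace =
      ∑ j, D j (χ * ∑ l, (mixedHessian D E v).adjugate l j * E l φ) -
        ∑ l, E l (φ * ∑ j, (mixedHessian D E v).adjugate l j * D j χ) := by
  set P := (mixedHessian D E v).adjugate
  have divergence_D : ∀ l, ∑ j, D j (P l j) = 0 := sum_derivation_adjugate_mixedHessian hD E v
  have divergence_E : ∀ j, ∑ l, E l (P.transpose j l) = 0 := by
    rw [Matrix.adjugate_transpose, mixedHessian_transpose hDE]
    exact sum_derivation_adjugate_mixedHessian hE D v
  have expand_D := sum_derivation_mul_eq_add D E divergence_D φ χ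
  have expand_E := sum_derivation_mul_eq_add E D divergence_E χ φ
  rw [← mixedHessian_transpose hDE, ← Matrix.transpose_mul, Matrix.trace_transpose,
    Matrix.trace_mul_comm, Finset.sum_comm (f := fun j l => P.transpose l j * _ * _)] at expand_E
  simp only [Matrix.transpose_apply] at expand_E
  rw [expand_D, expand_E]
  simp only [mul_right_comm _ (E _ φ)]
  ring

end Derivations

/-! ### Constant coefficient derivations of smooth functions -/

noncomputable section SmoothFunctions

theorem fderiv_fderiv_comm {E F : Type*} [NormedAddCommGroup E] [NormedSpace ℝ E]
    [NormedAddCommGroup F] [NormedSpace ℝ F] {f : E → F} (hf : ContDiff ℝ 2 f) (p v w : E) :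
    fderiv ℝ (fderiv ℝ f) p v w = fderiv ℝ (fderiv ℝ f) p w v :=
  (hf.contDiffAt.isSymmSndFDerivAt minSmoothness_of_isRCLikeNormedField.le).eq v w

/-- The algebra of smooth complex functions on a real normed space, on which the algebraic
identities for derivations are applied. -/
def smoothFunctions (V : Type*) [NormedAddCommGroup V] [NormedSpace ℝ V] :
    Subalgebra ℂ (V → ℂ) where
  carrier := {f | ContDiff ℝ ∞ f}
  mul_mem' {f g} (hf : ContDiff ℝ ∞ f) (hg : ContDiff ℝ ∞ g) := hf.mul hg
  add_mem' {f g} (hf : ContDiff ℝ ∞ f) (hg : ContDiff ℝ ∞ g) := hf.add hg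
  algebraMap_mem' c := show ContDiff ℝ ∞ fun _ => c from contDiff_const

variable {V : Type*} [NormedAddCommGroup V] [NormedSpace ℝ V]

theorem contDiff_smoothFunctions (f : smoothFunctions V) : ContDiff ℝ ∞ (f : V → ℂ) := f.2

theorem differentiableAt_smoothFunctions (f : smoothFunctions V) (p : V) :
    DifferentiableAt ℝ (f : V → ℂ) p :=
  (contDiff_smoothFunctions f).differentiable (by simp) p

theorem contDiff_fderiv_smoothFunctions (f : smoothFunctions V) :
    ContDiff ℝ ∞ (fderiv ℝ (f : V → ℂ)) :=
  (contDiff_smoothFunctions f).fderiv_right (by simp)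

/-- The ideal of the smooth functions with compact support, the test functions for integration
by parts. -/
def testFunctions (V : Type*) [NormedAddCommGroup V] [NormedSpace ℝ V] :
    Ideal (smoothFunctions V) where
  carrier := {f | HasCompactSupport (f : V → ℂ)}
  add_mem' := HasCompactSupport.add (β := ℂ)
  zero_mem' := HasCompactSupport.zero (β := ℂ)
  smul_mem' _ _ hf := hf.mul_left

/-- The directional derivative as a derivation of the algebra of smooth functions. -/
def dirDeriv (v : V) : Derivation ℂ (smoothFunctions V) (smoothFunctions V) :=
  Derivation.mk'
    { toFun := fun f => ⟨fun p => fderiv ℝ (f : V → ℂ) p v,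
        (contDiff_fderiv_smoothFunctions f).clm_apply contDiff_const⟩
      map_add' := fun f g => by
        ext p
        simp [fderiv_add (differentiableAt_smoothFunctions f p)
          (differentiableAt_smoothFunctions g p)]
      map_smul' := fun c f => by
        ext p
        simp [fderiv_const_smul (differentiableAt_smoothFunctions f p)] }
    (fun f g => by
      ext p
      simp [fderiv_mul (differentiableAt_smoothFunctions f p)
        (differentiableAt_smoothFunctions g p)])

theorem dirDeriv_apply (v : V) (f : smoothFunctions V) (p : V) :
    (dirDeriv v f : V → ℂ) p = fderiv ℝ (f : V → ℂ) p v := rfl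

theorem dirDeriv_dirDeriv_apply (v w : V) (f : smoothFunctions V) (p : V) :
    (dirDeriv v (dirDeriv w f) : V → ℂ) p = fderiv ℝ (fderiv ℝ (f : V → ℂ)) p v w := by
  change fderiv ℝ (fun q => fderiv ℝ (f : V → ℂ) q w) p v = _
  rw [fderiv_clm_apply ((contDiff_fderiv_smoothFunctions f).differentiable (by simp) p)
    (differentiableAt_const _)]
  simp

theorem dirDeriv_comm (v w : V) (f : smoothFunctions V) :
    dirDeriv v (dirDeriv w f) = dirDeriv w (dirDeriv v f) := by
  ext p
  rw [dirDeriv_dirDeriv_apply, dirDeriv_dirDeriv_apply]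
  exact fderiv_fderiv_comm ((contDiff_smoothFunctions f).of_le ENat.LEInfty.out) p v w

variable (V) in
/-- The derivations of the algebra of smooth functions with constant complex coefficients. The
Wirtinger derivatives are among them. -/
def constCoeffDerivations : Submodule ℂ (Derivation ℂ (smoothFunctions V) (smoothFunctions V)) :=
  Submodule.span ℂ (range dirDeriv)

theorem dirDeriv_mem_constCoeffDerivations (v : V) : dirDeriv v ∈ constCoeffDerivations V :=
  Submodule.subset_span (mem_range_self v)

theorem constCoeffDerivations_comm {D D' : Derivation ℂ (smoothFunctions V) (smoothFunctions V)}
    (hD : D ∈ constCoeffDerivations V) (hD' : D' ∈ constCoeffDerivations V)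
    (f : smoothFunctions V) : D (D' f) = D' (D f) := by
  induction hD, hD' using Submodule.span_induction₂ with
  | mem_mem D D' hD hD' =>
    obtain ⟨⟨v, rfl⟩, w, rfl⟩ := hD, hD'
    exact dirDeriv_comm v w f
  | zero_left => simp
  | zero_right => simp
  | add_left _ _ _ _ _ _ h₁ h₂ => simp [h₁, h₂]
  | add_right _ _ _ _ _ _ h₁ h₂ => simp [h₁, h₂]
  | smul_left _ _ _ _ _ h => simp [h]
  | smul_right _ _ _ _ _ h => simp [h]

theorem constCoeffDerivations_apply_mem_testFunctions
    {D : Derivation ℂ (smoothFunctions V) (smoothFunctions V)} (hD : D ∈ constCoeffDerivations V)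
    {f : smoothFunctions V} (hf : f ∈ testFunctions V) : D f ∈ testFunctions V := by
  induction hD using Submodule.span_induction with
  | mem D hD =>
    obtain ⟨v, rfl⟩ := hD
    exact HasCompactSupport.fderiv_apply (𝕜 := ℝ) hf v
  | zero => exact zero_mem _
  | add _ _ _ _ h₁ h₂ => exact add_mem h₁ h₂
  | smul c _ _ h => exact Submodule.smul_of_tower_mem _ c h

section Integration

variable [MeasurableSpace V] [BorelSpace V] {μ : Measure V}

theorem integrable_of_mem_testFunctions [IsFiniteMeasureOnCompacts μ] {f : smoothFunctions V}
    (hf : f ∈ testFunctions V) : Integrable (f : V → ℂ) μ :=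
  (contDiff_smoothFunctions f).continuous.integrable_of_hasCompactSupport hf

theorem integral_sub_of_mem_testFunctions [IsFiniteMeasureOnCompacts μ] {f g : smoothFunctions V}
    (hf : f ∈ testFunctions V) (hg : g ∈ testFunctions V) :
    ∫ p, ((f - g : smoothFunctions V) : V → ℂ) p ∂μ =
      ∫ p, (f : V → ℂ) p ∂μ - ∫ p, (g : V → ℂ) p ∂μ :=
  integral_sub (integrable_of_mem_testFunctions hf) (integrable_of_mem_testFunctions hg)

variable [FiniteDimensional ℝ V] [μ.IsAddHaarMeasure]

theorem integral_dirDeriv (v : V) {f : smoothFunctions V} (hf : f ∈ testFunctions V) :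
    ∫ p, (dirDeriv v f : V → ℂ) p ∂μ = 0 := by
  have deriv_integrable : Integrable (fun p => fderiv ℝ (f : V → ℂ) p v) μ :=
    integrable_of_mem_testFunctions
      (constCoeffDerivations_apply_mem_testFunctions (dirDeriv_mem_constCoeffDerivations v) hf)
  simpa [dirDeriv_apply] using integral_mul_fderiv_eq_neg_fderiv_mul_of_integrable (μ := μ)
    (f := fun _ => (1 : ℂ)) (g := f) (v := v) (by simp) (by simpa using deriv_integrable)
    (by simpa using integrable_of_mem_testFunctions hf) (by simp)
    (fun p _ => differentiableAt_smoothFunctions f p)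

theorem integral_constCoeffDerivations
    {D : Derivation ℂ (smoothFunctions V) (smoothFunctions V)} (hD : D ∈ constCoeffDerivations V)
    {f : smoothFunctions V} (hf : f ∈ testFunctions V) : ∫ p, (D f : V → ℂ) p ∂μ = 0 := by
  induction hD using Submodule.span_induction with
  | mem D hD =>
    obtain ⟨v, rfl⟩ := hD
    exact integral_dirDeriv v hf
  | zero => simp
  | add D₁ D₂ h₁ h₂ ih₁ ih₂ =>
    have int₁ := constCoeffDerivations_apply_mem_testFunctions h₁ hf
    have int₂ := constCoeffDerivations_apply_mem_testFunctions h₂ hf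
    have := integral_add (integrable_of_mem_testFunctions (μ := μ) int₁)
      (integrable_of_mem_testFunctions int₂)
    rwa [ih₁, ih₂, add_zero] at this
  | smul c D _ ih =>
    calc ∫ p, c * (D f : V → ℂ) p ∂μ = c * ∫ p, (D f : V → ℂ) p ∂μ := integral_const_mul c _
      _ = 0 := by rw [ih, mul_zero]

variable {ι : Type*} [Fintype ι]

theorem integral_sum_constCoeffDerivations
    {D : ι → Derivation ℂ (smoothFunctions V) (smoothFunctions V)}
    (hD : ∀ j, D j ∈ constCoeffDerivations V) {f : ι → smoothFunctions V}
    (hf : ∀ j, f j ∈ testFunctions V) :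
    ∫ p, ((∑ j, D j (f j) : smoothFunctions V) : V → ℂ) p ∂μ = 0 := by
  simp only [AddSubmonoidClass.coe_finsetSum, Finset.sum_apply]
  rw [integral_finsetSum _ fun j _ => integrable_of_mem_testFunctions
    (constCoeffDerivations_apply_mem_testFunctions (hD j) (hf j))]
  exact Finset.sum_eq_zero fun j _ => integral_constCoeffDerivations (hD j) (hf j)

theorem integral_mul_trace_adjugate_mixedHessian_comm [DecidableEq ι]
    {D E : ι → Derivation ℂ (smoothFunctions V) (smoothFunctions V)}
    (hD : ∀ j, D j ∈ constCoeffDerivations V) (hE : ∀ j, E j ∈ constCoeffDerivations V)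
    (v φ : smoothFunctions V) {χ : smoothFunctions V} (hχ : χ ∈ testFunctions V) :
    ∫ p, ((χ * ((mixedHessian D E v).adjugate * mixedHessian D E φ).trace :
        smoothFunctions V) : V → ℂ) p ∂μ =
      ∫ p, ((φ * ((mixedHessian D E v).adjugate * mixedHessian D E χ).trace :
        smoothFunctions V) : V → ℂ) p ∂μ := by
  have green := mul_trace_adjugate_sub_mul_trace_adjugate (D := D) (E := E)
    (fun i j => constCoeffDerivations_comm (hD i) (hD j))
    (fun i j => constCoeffDerivations_comm (hE i) (hE j))
    (fun i j => constCoeffDerivations_comm (hD i) (hE j)) v φ χ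
  have test_D : ∀ j, D j χ ∈ testFunctions V := fun j =>
    constCoeffDerivations_apply_mem_testFunctions (hD j) hχ
  have test_hessian : ∀ j l, mixedHessian D E χ j l ∈ testFunctions V := fun j l =>
    constCoeffDerivations_apply_mem_testFunctions (hD j)
      (constCoeffDerivations_apply_mem_testFunctions (hE l) hχ)
  have test_left := Ideal.mul_mem_right
    ((mixedHessian D E v).adjugate * mixedHessian D E φ).trace _ hχ
  have test_right : φ * ((mixedHessian D E v).adjugate * mixedHessian D E χ).trace ∈
      testFunctions V :=
    Ideal.mul_mem_left _ _ (sum_mem fun l _ => sum_mem fun j _ =>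
      Ideal.mul_mem_left _ _ (test_hessian j l))
  have test_flux_D : ∀ j, χ * ∑ l, (mixedHessian D E v).adjugate l j * E l φ ∈ testFunctions V :=
    fun j => Ideal.mul_mem_right _ _ hχ
  have test_flux_E : ∀ l, φ * ∑ j, (mixedHessian D E v).adjugate l j * D j χ ∈ testFunctions V :=
    fun l => Ideal.mul_mem_left _ _ (sum_mem fun j _ => Ideal.mul_mem_left _ _ (test_D j))
  rw [← sub_eq_zero, ← integral_sub_of_mem_testFunctions test_left test_right, green,
    integral_sub_of_mem_testFunctions
      (sum_mem fun j _ => constCoeffDerivations_apply_mem_testFunctions (hD j) (test_flux_D j))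
      (sum_mem fun l _ => constCoeffDerivations_apply_mem_testFunctions (hE l) (test_flux_E l)),
    integral_sum_constCoeffDerivations hD test_flux_D,
    integral_sum_constCoeffDerivations hE test_flux_E, sub_zero]

end Integration

end SmoothFunctions

/-! ### Positive semidefinite matrices -/

section PosSemidef

open scoped ComplexOrder MatrixOrder Matrix.Norms.L2Operator

variable {𝕜 ι : Type*} [RCLike 𝕜] [Fintype ι]

theorem re_trace_conjTranspose_mul_self (B : Matrix ι ι 𝕜) :
    RCLike.re (B.conjTranspose * B).trace = ∑ i, ∑ k, ‖B k i‖ ^ 2 := by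
  simp only [Matrix.trace, Matrix.diag_apply, Matrix.mul_apply, Matrix.conjTranspose_apply,
    map_sum, RCLike.star_def, RCLike.conj_mul]
  exact Finset.sum_congr rfl fun i _ => Finset.sum_congr rfl fun k _ => by
    rw [← RCLike.ofReal_pow, RCLike.ofReal_re]

variable {A B : Matrix ι ι 𝕜}

theorem exists_eq_conjTranspose_mul_self (hA : A.PosSemidef) :
    ∃ S : Matrix ι ι 𝕜, A = S.conjTranspose * S := by
  classical exact CStarAlgebra.nonneg_iff_eq_star_mul_self.1 hA.nonneg

theorem norm_apply_le_re_trace (hA : A.PosSemidef) (i j : ι) : ‖A i j‖ ≤ RCLike.re A.trace := by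
  obtain ⟨S, rfl⟩ := exists_eq_conjTranspose_mul_self hA
  have column_le : ∀ i, ∑ k, ‖S k i‖ ^ 2 ≤ RCLike.re (S.conjTranspose * S).trace := fun i => by
    rw [re_trace_conjTranspose_mul_self]
    exact Finset.single_le_sum (f := fun i => ∑ k, ‖S k i‖ ^ 2)
      (fun _ _ => Finset.sum_nonneg fun _ _ => sq_nonneg _) (Finset.mem_univ i)
  calc ‖(S.conjTranspose * S) i j‖ ≤ ∑ k, ‖S k i‖ * ‖S k j‖ := by
        rw [Matrix.mul_apply]
        refine (norm_sum_le _ _).trans_eq (Finset.sum_congr rfl fun k _ => ?_)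
        rw [norm_mul, Matrix.conjTranspose_apply, norm_star]
    _ ≤ ∑ k, (‖S k i‖ ^ 2 + ‖S k j‖ ^ 2) / 2 :=
        Finset.sum_le_sum fun k _ => by nlinarith [sq_nonneg (‖S k i‖ - ‖S k j‖)]
    _ = (∑ k, ‖S k i‖ ^ 2 + ∑ k, ‖S k j‖ ^ 2) / 2 := by
        rw [← Finset.sum_div, Finset.sum_add_distrib]
    _ ≤ RCLike.re (S.conjTranspose * S).trace := by linarith [column_le i, column_le j]

theorem norm_trace_mul_le (hA : A.PosSemidef) {b : ℝ} (hb : ∀ i j, ‖B i j‖ ≤ b) :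
    ‖(A * B).trace‖ ≤ (Fintype.card ι : ℝ) ^ 2 * b * RCLike.re A.trace := by
  calc ‖(A * B).trace‖ ≤ ∑ i, ∑ j, ‖A i j * B j i‖ :=
        (norm_sum_le _ _).trans (Finset.sum_le_sum fun i _ => norm_sum_le _ _)
    _ ≤ ∑ _i : ι, ∑ _j : ι, RCLike.re A.trace * b := by
        gcongr with i _ j _
        rw [norm_mul]
        exact mul_le_mul (norm_apply_le_re_trace hA i j) (hb j i) (norm_nonneg _)
          ((norm_nonneg _).trans (norm_apply_le_re_trace hA i j))
    _ = (Fintype.card ι : ℝ) ^ 2 * b * RCLike.re A.trace := by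
        simp only [Finset.sum_const, Finset.card_univ, nsmul_eq_mul]
        ring

variable [DecidableEq ι]

theorem posSemidef_adjugate (hA : A.PosSemidef) : A.adjugate.PosSemidef := by
  obtain ⟨S, rfl⟩ := exists_eq_conjTranspose_mul_self hA
  rw [Matrix.adjugate_mul_distrib, ← Matrix.adjugate_conjTranspose]
  exact Matrix.posSemidef_self_mul_conjTranspose _

theorem det_one_add_eq_prod_eigenvalues (hA : A.IsHermitian) :
    (1 + A).det = ∏ i, ((1 + hA.eigenvalues i : ℝ) : 𝕜) := by
  have charpoly_eval : (Matrix.scalar ι (-1 : 𝕜) - A).det =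
      ∏ i, ((-1 : 𝕜) - (hA.eigenvalues i : 𝕜)) := by
    rw [← Matrix.eval_charpoly, hA.charpoly_eq, Polynomial.eval_prod]
    simp
  have neg_eq : Matrix.scalar ι (-1 : 𝕜) - A = -(1 + A) := by
    rw [map_neg, map_one]
    abel
  rw [neg_eq, Matrix.det_neg] at charpoly_eval
  refine mul_left_cancel₀ (pow_ne_zero (Fintype.card ι) (neg_ne_zero.2 one_ne_zero))
    (charpoly_eval.trans ?_)
  rw [Fintype.card, ← Finset.prod_const, ← Finset.prod_mul_distrib]
  refine Finset.prod_congr rfl fun i _ => ?_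
  push_cast
  ring

theorem one_le_det_one_add (hA : A.PosSemidef) : 1 ≤ (1 + A).det := by
  rw [det_one_add_eq_prod_eigenvalues hA.1, ← RCLike.ofReal_prod, ← RCLike.ofReal_one,
    RCLike.ofReal_le_ofReal]
  exact Finset.one_le_prod fun i _ => by linarith [hA.eigenvalues_nonneg i]

theorem det_le_det_add (hA : A.PosSemidef) (hB : B.PosSemidef) : A.det ≤ (A + B).det := by
  obtain ⟨S, rfl⟩ := exists_eq_conjTranspose_mul_self hA
  rcases eq_or_ne S.det 0 with singular | regular
  · rw [Matrix.det_mul, singular, mul_zero]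
    exact (hA.add hB).det_nonneg
  have unit_S : IsUnit S.det := regular.isUnit
  have unit_S' : IsUnit S.conjTranspose.det := S.det_conjTranspose ▸ unit_S.star
  set P := (S⁻¹).conjTranspose * B * S⁻¹
  have factor : S.conjTranspose * S + B = S.conjTranspose * (1 + P) * S := by
    simp only [P, Matrix.mul_add, Matrix.add_mul, Matrix.mul_one, Matrix.mul_assoc,
      Matrix.conjTranspose_nonsing_inv]
    rw [Matrix.nonsing_inv_mul _ unit_S, Matrix.mul_one,
      Matrix.mul_nonsing_inv_cancel_left _ _ unit_S']
  calc (S.conjTranspose * S).det = (S.conjTranspose * S).det * 1 := (mul_one _).symm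
    _ ≤ (S.conjTranspose * S).det * (1 + P).det :=
        mul_le_mul_of_nonneg_left (one_le_det_one_add (hB.conjTranspose_mul_mul_same _))
          hA.det_nonneg
    _ = (S.conjTranspose * S + B).det := by
        rw [factor, Matrix.det_mul, Matrix.det_mul, Matrix.det_mul]
        ring

end PosSemidef

/-! ### The complex Hessian -/

noncomputable section ComplexHessian

variable {n : ℕ}

theorem wirtinger_congr {f g : Cn n → ℂ} {p : Cn n} (h : f =ᶠ[𝓝 p] g) (j : Fin n) :
    wirtinger j f =ᶠ[𝓝 p] wirtinger j g := by
  filter_upwards [h.fderiv (𝕜 := ℝ)] with q hq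
  simp only [wirtinger, hq]

theorem wirtingerBar_congr {f g : Cn n → ℂ} {p : Cn n} (h : f =ᶠ[𝓝 p] g) (j : Fin n) :
    wirtingerBar j f =ᶠ[𝓝 p] wirtingerBar j g := by
  filter_upwards [h.fderiv (𝕜 := ℝ)] with q hq
  simp only [wirtingerBar, hq]

theorem complexHessian_congr {u v : Cn n → ℝ} {p : Cn n} (h : u =ᶠ[𝓝 p] v) :
    complexHessian u p = complexHessian v p := by
  ext j k
  exact (wirtinger_congr (wirtingerBar_congr (h.fun_comp Complex.ofReal) k) j).self_of_nhds

theorem mongeAmpereDensity_congr {u v : Cn n → ℝ} {p : Cn n} (h : u =ᶠ[𝓝 p] v) :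
    mongeAmpereDensity u p = mongeAmpereDensity v p := by
  simp only [mongeAmpereDensity, complexHessian_congr h]

/-- The Wirtinger derivative `∂/∂z_j` as a derivation of the algebra of smooth functions. -/
def wirtingerDerivation (j : Fin n) :
    Derivation ℂ (smoothFunctions (Cn n)) (smoothFunctions (Cn n)) :=
  (1 / 2 : ℂ) • (dirDeriv (stdVec j) + (-Complex.I) • dirDeriv (Complex.I • stdVec j))

/-- The conjugate Wirtinger derivative `∂/∂z̄_j` as a derivation of the algebra of smooth
functions. -/
def wirtingerBarDerivation (j : Fin n) :
    Derivation ℂ (smoothFunctions (Cn n)) (smoothFunctions (Cn n)) :=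
  (1 / 2 : ℂ) • (dirDeriv (stdVec j) + Complex.I • dirDeriv (Complex.I • stdVec j))

theorem wirtingerDerivation_mem (j : Fin n) :
    wirtingerDerivation j ∈ constCoeffDerivations (Cn n) := by
  have mem := dirDeriv_mem_constCoeffDerivations (V := Cn n)
  exact Submodule.smul_mem _ (1 / 2 : ℂ) (Submodule.add_mem _ (mem (stdVec j))
    (Submodule.smul_mem _ (-Complex.I) (mem (Complex.I • stdVec j))))

theorem wirtingerBarDerivation_mem (j : Fin n) :
    wirtingerBarDerivation j ∈ constCoeffDerivations (Cn n) := by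
  have mem := dirDeriv_mem_constCoeffDerivations (V := Cn n)
  exact Submodule.smul_mem _ (1 / 2 : ℂ) (Submodule.add_mem _ (mem (stdVec j))
    (Submodule.smul_mem _ Complex.I (mem (Complex.I • stdVec j))))

/-- A smooth real function as an element of the algebra of smooth complex functions. -/
def smoothOfReal (u : Cn n → ℝ) (hu : ContDiff ℝ ∞ u) : smoothFunctions (Cn n) :=
  ⟨fun w => (u w : ℂ), Complex.ofRealCLM.contDiff.comp hu⟩

theorem smoothOfReal_mem_testFunctions {u : Cn n → ℝ} (hu : ContDiff ℝ ∞ u)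
    (hc : HasCompactSupport u) : smoothOfReal u hu ∈ testFunctions (Cn n) :=
  hc.comp_left (g := Complex.ofReal) Complex.ofReal_zero

theorem complexHessian_apply {u : Cn n → ℝ} (hu : ContDiff ℝ ∞ u) (p : Cn n) (j k : Fin n) :
    complexHessian u p j k =
      (wirtingerDerivation j (wirtingerBarDerivation k (smoothOfReal u hu)) : Cn n → ℂ) p := by
  simp only [complexHessian, Matrix.of_apply, wirtinger, sub_eq_add_neg, ← neg_mul]
  rfl

theorem continuous_complexHessian {u : Cn n → ℝ} (hu : ContDiff ℝ ∞ u) :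
    Continuous (complexHessian u) :=
  continuous_matrix fun j k => by
    simpa only [complexHessian_apply hu] using (contDiff_smoothFunctions
      (wirtingerDerivation j (wirtingerBarDerivation k (smoothOfReal u hu)))).continuous

theorem complexHessian_add {u v : Cn n → ℝ} (hu : ContDiff ℝ ∞ u) (hv : ContDiff ℝ ∞ v)
    (p : Cn n) :
    complexHessian (fun z => u z + v z) p = complexHessian u p + complexHessian v p := by
  ext j k
  have smooth_add : smoothOfReal (fun z => u z + v z) (hu.add hv) =
      smoothOfReal u hu + smoothOfReal v hv := by
    ext p; simp [smoothOfReal]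
  rw [complexHessian_apply (hu.add hv), smooth_add, map_add, map_add, Matrix.add_apply,
    complexHessian_apply hu, complexHessian_apply hv]
  rfl

theorem complexHessian_const_mul (c : ℝ) {u : Cn n → ℝ} (hu : ContDiff ℝ ∞ u)
    (p : Cn n) : complexHessian (fun z => c * u z) p = (c : ℂ) • complexHessian u p := by
  ext j k
  have smooth_smul : smoothOfReal (fun z => c * u z) (contDiff_const.mul hu) =
      (c : ℂ) • smoothOfReal u hu := by
    ext p; simp [smoothOfReal]
  rw [complexHessian_apply (contDiff_const.mul hu), smooth_smul, Derivation.map_smul,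
    Derivation.map_smul, Matrix.smul_apply, complexHessian_apply hu]
  rfl

theorem complexHessian_const (c : ℝ) (p : Cn n) :
    complexHessian (fun _ : Cn n => c) p = 0 := by
  ext j k
  have smooth_const : smoothOfReal (n := n) (fun _ => c) contDiff_const =
      algebraMap ℂ _ (c : ℂ) := rfl
  rw [complexHessian_apply contDiff_const, smooth_const, Derivation.map_algebraMap, map_zero]
  rfl

theorem complexHessian_eq_zero_of_notMem_tsupport {u : Cn n → ℝ} {p : Cn n}
    (hp : p ∉ tsupport u) : complexHessian u p = 0 := by
  rw [complexHessian_congr (notMem_tsupport_iff_eventuallyEq.1 hp)]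
  exact complexHessian_const 0 p

theorem exists_norm_complexHessian_le {χ : Cn n → ℝ} (hχ : ContDiff ℝ ∞ χ)
    (hc : HasCompactSupport χ) : ∃ b : ℝ, 0 ≤ b ∧ ∀ p i j, ‖complexHessian χ p i j‖ ≤ b := by
  have entry_le : ∀ ij : Fin n × Fin n, ∃ b, ∀ p, ‖complexHessian χ p ij.1 ij.2‖ ≤ b := fun ij =>
    (HasCompactSupport.intro hc.isCompact fun p hp => by
      simp only [complexHessian_eq_zero_of_notMem_tsupport hp,
        Matrix.zero_apply]).exists_bound_of_continuous
      ((continuous_complexHessian hχ).matrix_elem ij.1 ij.2)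
  choose b hb using entry_le
  obtain ⟨B, hB⟩ := Finite.exists_le b
  exact ⟨max B 0, le_max_right _ _, fun p i j =>
    (hb (i, j) p).trans ((hB (i, j)).trans (le_max_left _ _))⟩

/-- The complex Hessian along the coordinates selected by `e`, on which the induction on the
dimension in the Chern-Levine-Nirenberg inequality runs. -/
def subHessian {κ : Type*} (e : κ → Fin n) (u : Cn n → ℝ) (p : Cn n) : Matrix κ κ ℂ :=
  (complexHessian u p).submatrix e e

theorem continuous_subHessian {κ : Type*} (e : κ → Fin n) {u : Cn n → ℝ}
    (hu : ContDiff ℝ ∞ u) : Continuous (subHessian e u) :=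
  (continuous_complexHessian hu).matrix_submatrix e e

variable {κ : Type*} [Fintype κ] [DecidableEq κ]

theorem trace_adjugate_subHessian_mul (e : κ → Fin n) {v φ : Cn n → ℝ} (hv : ContDiff ℝ ∞ v)
    (hφ : ContDiff ℝ ∞ φ) (p : Cn n) :
    ((subHessian e v p).adjugate * subHessian e φ p).trace =
      (((mixedHessian (wirtingerDerivation ∘ e) (wirtingerBarDerivation ∘ e)
          (smoothOfReal v hv)).adjugate *
        mixedHessian (wirtingerDerivation ∘ e) (wirtingerBarDerivation ∘ e)
          (smoothOfReal φ hφ)).trace : Cn n → ℂ) p := by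
  let evalAt : smoothFunctions (Cn n) →+* ℂ :=
    (Pi.evalRingHom (fun _ : Cn n => ℂ) p).comp (smoothFunctions (Cn n)).val.toRingHom
  have eval_hessian : ∀ {u : Cn n → ℝ} (hu : ContDiff ℝ ∞ u), evalAt.mapMatrix
      (mixedHessian (wirtingerDerivation ∘ e) (wirtingerBarDerivation ∘ e) (smoothOfReal u hu)) =
        subHessian e u p := fun hu => by
    ext i j
    exact (complexHessian_apply hu p (e i) (e j)).symm
  rw [← eval_hessian hv, ← eval_hessian hφ, ← RingHom.map_adjugate, ← map_mul]
  exact (AddMonoidHom.map_trace evalAt.toAddMonoidHom _).symm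

theorem integral_mul_trace_adjugate_subHessian_comm (e : κ → Fin n) {v φ χ : Cn n → ℝ}
    (hv : ContDiff ℝ ∞ v) (hφ : ContDiff ℝ ∞ φ) (hχ : ContDiff ℝ ∞ χ)
    (hc : HasCompactSupport χ) :
    ∫ p, (χ p : ℂ) * ((subHessian e v p).adjugate * subHessian e φ p).trace =
      ∫ p, (φ p : ℂ) * ((subHessian e v p).adjugate * subHessian e χ p).trace := by
  simp only [trace_adjugate_subHessian_mul e hv hφ, trace_adjugate_subHessian_mul e hv hχ]
  exact integral_mul_trace_adjugate_mixedHessian_comm (fun j => wirtingerDerivation_mem (e j))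
    (fun j => wirtingerBarDerivation_mem (e j)) _ (smoothOfReal φ hφ)
    (smoothOfReal_mem_testFunctions hχ hc)

end ComplexHessian

/-! ### The Chern-Levine-Nirenberg inequality -/

noncomputable section ChernLevineNirenberg

open scoped ComplexOrder

theorem exists_smooth_cutoff {E : Type*} [NormedAddCommGroup E] [NormedSpace ℝ E]
    [FiniteDimensional ℝ E] {K U : Set E} (hK : IsCompact K) (hU : IsOpen U) (hKU : K ⊆ U) :
    ∃ χ : E → ℝ, ContDiff ℝ ∞ χ ∧ HasCompactSupport χ ∧ tsupport χ ⊆ U ∧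
      (∀ x ∈ K, χ x = 1) ∧ ∀ x, χ x ∈ Icc (0 : ℝ) 1 := by
  obtain ⟨L, hL, hKL, hLU⟩ := exists_compact_between hK hU hKU
  obtain ⟨χ, one_nhds, zero_off, hχ⟩ := exists_contMDiffMap_one_nhds_of_subset_interior
    (n := ⊤) (modelWithCornersSelf ℝ E) hK.isClosed hKL
  have tsupport_subset : tsupport χ ⊆ L :=
    closure_minimal (fun x hx => by_contra fun h => hx (zero_off x h)) hL.isClosed
  exact ⟨χ, χ.contMDiff.contDiff, HasCompactSupport.of_support_subset_isCompact hL
    ((subset_tsupport _).trans tsupport_subset), tsupport_subset.trans hLU,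
    one_nhds.self_of_nhdsSet, hχ⟩

theorem setIntegral_le_integral_mul {X : Type*} [MeasurableSpace X] {μ : Measure X} {s : Set X}
    {f g : X → ℝ} (hs : MeasurableSet s) (hf : ∀ x ∈ s, f x = 1) (hfg : ∀ x, 0 ≤ f x * g x)
    (hint : Integrable (fun x => f x * g x) μ) : ∫ x in s, g x ∂μ ≤ ∫ x, f x * g x ∂μ :=
  calc ∫ x in s, g x ∂μ = ∫ x in s, f x * g x ∂μ :=
        setIntegral_congr_fun hs fun x hx => by simp only [hf x hx, one_mul]
    _ ≤ ∫ x, f x * g x ∂μ := setIntegral_le_integral hint (Eventually.of_forall hfg)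

theorem re_integral_ofReal_mul {X : Type*} [MeasurableSpace X] {μ : Measure X} {f : X → ℝ}
    {g : X → ℂ} (hint : Integrable (fun x => (f x : ℂ) * g x) μ) :
    (∫ x, (f x : ℂ) * g x ∂μ).re = ∫ x, f x * (g x).re ∂μ := by
  simpa only [RCLike.re_eq_complex_re, Complex.re_ofReal_mul] using (integral_re hint).symm

variable {n : ℕ}

/-- The smooth competitors of the a priori estimates: `v` is smooth on all of `ℂⁿ`, and on `V` it
is bounded by `M` and plurisubharmonic in the sense that its complex Hessian is positive
semidefinite. -/
structure IsSmoothPSH (V : Set (Cn n)) (M : ℝ) (v : Cn n → ℝ) : Prop where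
  contDiff : ContDiff ℝ ∞ v
  posSemidef : ∀ p ∈ V, (complexHessian v p).PosSemidef
  bound : ∀ p ∈ V, |v p| ≤ M

variable {V K : Set (Cn n)} {M : ℝ} {v : Cn n → ℝ}

theorem IsSmoothPSH.subHessian {κ : Type*} (hv : IsSmoothPSH V M v) (e : κ → Fin n) {p : Cn n}
    (hp : p ∈ V) : (subHessian e v p).PosSemidef :=
  (hv.posSemidef p hp).submatrix e

section FiniteIndex

variable {κ : Type*} [Fintype κ] [DecidableEq κ] (e : κ → Fin n)

theorem continuous_det_subHessian (hv : ContDiff ℝ ∞ v) :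
    Continuous fun p => (subHessian e v p).det :=
  (continuous_subHessian e hv).matrix_det

/-- The trace of the adjugate of the Hessian along the coordinates selected by `e`: the density of
the mixed measure `(dd^c v)^{k-1} ∧ dd^c |z|²` in these `k` coordinates, up to a constant. -/
def adjugateTrace (v : Cn n → ℝ) (p : Cn n) : ℝ :=
  (subHessian e v p).adjugate.trace.re

theorem continuous_adjugateTrace (hv : ContDiff ℝ ∞ v) : Continuous (adjugateTrace e v) :=
  Complex.continuous_re.comp (continuous_subHessian e hv).matrix_adjugate.matrix_trace

theorem norm_integral_trace_adjugate_le {m b : ℝ} {φ χ : Cn n → ℝ} (hv : IsSmoothPSH V M v)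
    (hφ : ContDiff ℝ ∞ φ) (hφm : ∀ p ∈ V, |φ p| ≤ m) (hχ : ContDiff ℝ ∞ χ)
    (hc : HasCompactSupport χ) (hV : tsupport χ ⊆ V)
    (hb : ∀ p i j, ‖complexHessian χ p i j‖ ≤ b) :
    ‖∫ p, (χ p : ℂ) * ((subHessian e v p).adjugate * subHessian e φ p).trace‖ ≤
      m * ((Fintype.card κ : ℝ) ^ 2 * b) * ∫ p in tsupport χ, adjugateTrace e v p := by
  have integrable_trace : IntegrableOn (adjugateTrace e v) (tsupport χ) :=
    (continuous_adjugateTrace e hv.contDiff).continuousOn.integrableOn_compact hc.isCompact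
  rw [integral_mul_trace_adjugate_subHessian_comm e hv.contDiff hφ hχ hc,
    ← setIntegral_eq_integral_of_forall_compl_eq_zero (s := tsupport χ) fun p hp => by
      simp [subHessian, complexHessian_eq_zero_of_notMem_tsupport hp], ← integral_const_mul]
  refine norm_integral_le_of_norm_le (integrable_trace.const_mul _)
    ((ae_restrict_iff' (isClosed_tsupport χ).measurableSet).2 (Eventually.of_forall fun p hp => ?_))
  have trace_le := norm_trace_mul_le (posSemidef_adjugate (hv.subHessian e (hV hp)))
    (B := subHessian e χ p) (fun i j => hb p (e i) (e j))
  rw [norm_mul, Complex.norm_real, Real.norm_eq_abs, mul_assoc]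
  exact mul_le_mul (hφm p (hV hp)) trace_le (norm_nonneg _)
    ((abs_nonneg _).trans (hφm p (hV hp)))

theorem trace_adjugate_mul_self {R : Type*} [CommRing R] (A : Matrix κ κ R) :
    (A.adjugate * A).trace = Fintype.card κ * A.det := by
  rw [Matrix.adjugate_mul, Matrix.trace_smul, Matrix.trace_one, smul_eq_mul, mul_comm]

theorem setIntegral_det_subHessian_le [Nonempty κ] {b : ℝ} {χ : Cn n → ℝ}
    (hv : IsSmoothPSH V M v) (hχ : ContDiff ℝ ∞ χ) (hc : HasCompactSupport χ)
    (hV : tsupport χ ⊆ V) (hK : IsCompact K) (hχK : ∀ p ∈ K, χ p = 1) (hχ0 : ∀ p, 0 ≤ χ p)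
    (hb : ∀ p i j, ‖complexHessian χ p i j‖ ≤ b) :
    ∫ p in K, (subHessian e v p).det.re ≤
      |M| * ((Fintype.card κ : ℝ) ^ 2 * b) * ∫ p in tsupport χ, adjugateTrace e v p := by
  have det_nonneg : ∀ p, 0 ≤ χ p * (subHessian e v p).det.re := fun p => by
    by_cases hp : p ∈ tsupport χ
    · exact mul_nonneg (hχ0 p)
        (Complex.nonneg_iff.1 (hv.subHessian e (hV hp)).det_nonneg).1
    · rw [image_eq_zero_of_notMem_tsupport hp, zero_mul]
  have det_continuous := continuous_det_subHessian e hv.contDiff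
  have integrable_det : Integrable fun p => χ p * (subHessian e v p).det.re :=
    (hχ.continuous.mul (Complex.continuous_re.comp
      det_continuous)).integrable_of_hasCompactSupport hc.mul_right
  have integrable_det' : Integrable fun p => (χ p : ℂ) * (subHessian e v p).det :=
    ((Complex.continuous_ofReal.comp hχ.continuous).mul
      det_continuous).integrable_of_hasCompactSupport
        (HasCompactSupport.mul_right (hc.comp_left Complex.ofReal_zero))
  have card_pos : (1 : ℝ) ≤ Fintype.card κ := Nat.one_le_cast.2 Fintype.card_pos
  calc ∫ p in K, (subHessian e v p).det.re
      ≤ ∫ p, χ p * (subHessian e v p).det.re :=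
        setIntegral_le_integral_mul hK.measurableSet hχK det_nonneg integrable_det
    _ ≤ Fintype.card κ * ∫ p, χ p * (subHessian e v p).det.re :=
        le_mul_of_one_le_left (integral_nonneg det_nonneg) card_pos
    _ = (∫ p, (χ p : ℂ) * ((subHessian e v p).adjugate * subHessian e v p).trace).re := by
        simp only [trace_adjugate_mul_self, mul_left_comm _ (Fintype.card κ : ℂ)]
        rw [integral_const_mul, ← Complex.ofReal_natCast, Complex.re_ofReal_mul,
          re_integral_ofReal_mul integrable_det']
    _ ≤ _ := (Complex.re_le_norm _).trans (norm_integral_trace_adjugate_le e hv hv.contDiff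
        (fun p hp => (hv.bound p hp).trans (le_abs_self M)) hχ hc hV hb)

end FiniteIndex

theorem setIntegral_adjugateTrace_succ {k : ℕ} (e : Fin (k + 1) → Fin n) (hK : IsCompact K)
    (hv : ContDiff ℝ ∞ v) :
    ∫ p in K, adjugateTrace e v p =
      ∑ i : Fin (k + 1), ∫ p in K, (subHessian (e ∘ i.succAbove) v p).det.re := by
  have trace_eq : ∀ p, adjugateTrace e v p =
      ∑ i : Fin (k + 1), (subHessian (e ∘ i.succAbove) v p).det.re := fun p => by
    rw [adjugateTrace, Matrix.trace, Complex.re_sum]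
    refine Finset.sum_congr rfl fun i _ => ?_
    rw [Matrix.diag_apply, Matrix.adjugate_fin_succ_eq_det_submatrix, Even.neg_one_pow ⟨_, rfl⟩,
      one_mul]
    rfl
  simp only [trace_eq]
  exact integral_finsetSum _ fun i _ => (Complex.continuous_re.comp
    (continuous_det_subHessian _ hv)).continuousOn.integrableOn_compact hK

theorem exists_setIntegral_det_subHessian_le (hV : IsOpen V) (M : ℝ) (k : ℕ) :
    ∀ (e : Fin k → Fin n) (K : Set (Cn n)), IsCompact K → K ⊆ V →
      ∃ C : ℝ, 0 ≤ C ∧ ∀ v, IsSmoothPSH V M v → ∫ p in K, (subHessian e v p).det.re ≤ C := by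
  induction k with
  | zero => exact fun e K _ _ => ⟨volume.real K, measureReal_nonneg, fun v _ => by simp⟩
  | succ k ih =>
    intro e K hK hKV
    obtain ⟨χ, hχ, hc, hcV, one_on, mem_Icc⟩ := exists_smooth_cutoff hK hV hKV
    obtain ⟨b, hb0, hb⟩ := exists_norm_complexHessian_le hχ hc
    choose C hC0 hC using fun i : Fin (k + 1) =>
      ih (e ∘ i.succAbove) (tsupport χ) hc.isCompact hcV
    have sum_nonneg : 0 ≤ ∑ i, C i := Finset.sum_nonneg fun i _ => hC0 i
    refine ⟨|M| * ((Fintype.card (Fin (k + 1)) : ℝ) ^ 2 * b) * ∑ i, C i, by positivity,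
      fun v hv => ?_⟩
    refine (setIntegral_det_subHessian_le e hv hχ hc hcV hK one_on
      (fun p => (mem_Icc p).1) hb).trans (mul_le_mul_of_nonneg_left ?_ (by positivity))
    rw [setIntegral_adjugateTrace_succ e hc.isCompact hv.contDiff]
    exact Finset.sum_le_sum fun i _ => hC i v hv

theorem exists_setIntegral_adjugateTrace_le (hV : IsOpen V) (M : ℝ) {k : ℕ} (e : Fin k → Fin n)
    (hK : IsCompact K) (hKV : K ⊆ V) :
    ∃ C : ℝ, 0 ≤ C ∧ ∀ v, IsSmoothPSH V M v → ∫ p in K, adjugateTrace e v p ≤ C := by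
  cases k with
  | zero => exact ⟨0, le_rfl, fun v _ => by simp [adjugateTrace]⟩
  | succ k =>
    choose C hC0 hC using fun i : Fin (k + 1) =>
      exists_setIntegral_det_subHessian_le hV M k (e ∘ i.succAbove) K hK hKV
    refine ⟨∑ i, C i, Finset.sum_nonneg fun i _ => hC0 i, fun v hv => ?_⟩
    rw [setIntegral_adjugateTrace_succ e hK hv.contDiff]
    exact Finset.sum_le_sum fun i _ => hC i v hv

end ChernLevineNirenberg

/-! ### Stability of the Monge-Ampère operator -/

noncomputable section Stability

open scoped ComplexOrder

theorem hasDerivAt_det_add_smul {𝕜 ι : Type*} [NontriviallyNormedField 𝕜] [Fintype ι]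
    [DecidableEq ι] (A B : Matrix ι ι 𝕜) (t : 𝕜) :
    HasDerivAt (fun s => (A + s • B).det) ((A + t • B).adjugate * B).trace t := by
  let P : Matrix ι ι (Polynomial 𝕜) :=
    Matrix.of fun i j => Polynomial.C (A i j) + Polynomial.X * Polynomial.C (B i j)
  have eval_P : ∀ s, (Polynomial.evalRingHom s).mapMatrix P = A + s • B := fun s => by
    ext i j
    simpa [P] using mul_comm (B i j) s
  have derivative_P : P.map (Polynomial.derivative' (R := 𝕜)) = B.map Polynomial.C := by
    ext1 i j
    simp [P]
  have eval_det : ∀ s, P.det.eval s = (A + s • B).det := fun s => by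
    rw [← eval_P, ← RingHom.map_det, Polynomial.coe_evalRingHom]
  have derivative_det : P.det.derivative = (P.adjugate * B.map Polynomial.C).trace := by
    rw [← derivative_P]
    exact derivation_det Polynomial.derivative' P
  have eval_B : (Polynomial.evalRingHom t).mapMatrix (B.map Polynomial.C) = B := by
    ext i j
    simp
  have eval_derivative :
      P.det.derivative.eval t = ((A + t • B).adjugate * B).trace := by
    rw [derivative_det]
    calc Polynomial.evalRingHom t (P.adjugate * B.map Polynomial.C).trace
        = ((Polynomial.evalRingHom t).mapMatrix (P.adjugate * B.map Polynomial.C)).trace :=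
          AddMonoidHom.map_trace (Polynomial.evalRingHom t).toAddMonoidHom _
      _ = ((A + t • B).adjugate * B).trace := by
          rw [map_mul, RingHom.map_adjugate, eval_P, eval_B]
  simpa only [eval_det, eval_derivative] using P.det.hasDerivAt t

variable {n : ℕ}

section Integrals

variable {f v : Cn n → ℝ}

theorem hasDerivAt_integral_mul_det_add_smul (hf : Continuous f) (hfc : HasCompactSupport f)
    {A B : Cn n → Matrix (Fin n) (Fin n) ℂ} (hA : Continuous A) (hB : Continuous B) (t : ℝ) :
    HasDerivAt (fun s : ℝ => ∫ p, (f p : ℂ) * (A p + (s : ℂ) • B p).det)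
      (∫ p, (f p : ℂ) * ((A p + (t : ℂ) • B p).adjugate * B p).trace) t := by
  let F : ℝ × Cn n → ℂ := fun q => (f q.2 : ℂ) * (A q.2 + (q.1 : ℂ) • B q.2).det
  let F' : ℝ × Cn n → ℂ := fun q =>
    (f q.2 : ℂ) * ((A q.2 + (q.1 : ℂ) • B q.2).adjugate * B q.2).trace
  have line_continuous : Continuous fun q : ℝ × Cn n => A q.2 + (q.1 : ℂ) • B q.2 :=
    (hA.comp continuous_snd).add
      ((Complex.continuous_ofReal.comp continuous_fst).smul (hB.comp continuous_snd))
  have f_continuous : Continuous fun q : ℝ × Cn n => (f q.2 : ℂ) :=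
    Complex.continuous_ofReal.comp (hf.comp continuous_snd)
  have F_continuous : Continuous F := f_continuous.mul line_continuous.matrix_det
  have F'_continuous : Continuous F' := f_continuous.mul
    (line_continuous.matrix_adjugate.matrix_mul (hB.comp continuous_snd)).matrix_trace
  obtain ⟨b, hb⟩ := ((isCompact_Icc (a := t - 1) (b := t + 1)).prod
    hfc.isCompact).exists_bound_of_continuousOn F'_continuous.continuousOn
  have compact_support : HasCompactSupport fun p => (f p : ℂ) :=
    hfc.comp_left Complex.ofReal_zero
  refine (hasDerivAt_integral_of_dominated_loc_of_deriv_le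
    (bound := (tsupport f).indicator fun _ => b) (s := Icc (t - 1) (t + 1))
    (F := fun s p => F (s, p)) (F' := fun s p => F' (s, p))
    (Icc_mem_nhds (by linarith) (by linarith)) ?_ ?_ ?_ ?_ ?_ ?_).2
  · exact Eventually.of_forall fun s => (F_continuous.comp (by fun_prop)).aestronglyMeasurable
  · exact (F_continuous.comp (by fun_prop)).integrable_of_hasCompactSupport
      compact_support.mul_right
  · exact (F'_continuous.comp (by fun_prop)).aestronglyMeasurable
  · refine Eventually.of_forall fun p s hs => ?_
    by_cases hp : p ∈ tsupport f
    · rw [indicator_of_mem hp]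
      exact hb (s, p) ⟨hs, hp⟩
    · simp [F', image_eq_zero_of_notMem_tsupport hp, hp]
  · exact (integrable_indicator_iff (isClosed_tsupport f).measurableSet).2
      (integrableOn_const hfc.isCompact.measure_lt_top.ne)
  · exact Eventually.of_forall fun p s _ =>
      (hasDerivAt_det_add_smul (A p) (B p) (s : ℂ)).comp_ofReal.const_mul (f p : ℂ)

theorem continuous_mongeAmpereDensity (hv : ContDiff ℝ ∞ v) :
    Continuous (mongeAmpereDensity v) :=
  continuous_const.mul (Complex.continuous_re.comp (continuous_complexHessian hv).matrix_det)

theorem integrable_mul_mongeAmpereDensity (hf : Continuous f) (hfc : HasCompactSupport f)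
    (hv : ContDiff ℝ ∞ v) : Integrable fun p => f p * mongeAmpereDensity v p :=
  (hf.mul (continuous_mongeAmpereDensity hv)).integrable_of_hasCompactSupport hfc.mul_right

theorem integral_mul_mongeAmpereDensity (hf : Continuous f) (hfc : HasCompactSupport f)
    (hv : ContDiff ℝ ∞ v) :
    ∫ p, f p * mongeAmpereDensity v p =
      (4 : ℝ) ^ n * (n.factorial : ℝ) * (∫ p, (f p : ℂ) * (complexHessian v p).det).re := by
  have compact_support : HasCompactSupport fun p => (f p : ℂ) :=
    hfc.comp_left Complex.ofReal_zero
  rw [re_integral_ofReal_mul (((Complex.continuous_ofReal.comp hf).mul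
    (continuous_complexHessian hv).matrix_det).integrable_of_hasCompactSupport
      compact_support.mul_right), ← integral_const_mul]
  simp only [mongeAmpereDensity, mul_left_comm (f _)]

end Integrals

variable {V K : Set (Cn n)} {M : ℝ} {f v w : Cn n → ℝ}

theorem IsSmoothPSH.segment (hv : IsSmoothPSH V M v) (hw : IsSmoothPSH V M w) {t : ℝ}
    (h0 : 0 ≤ t) (h1 : t ≤ 1) : IsSmoothPSH V M fun p => (1 - t) * w p + t * v p where
  contDiff := (contDiff_const.mul hw.contDiff).add (contDiff_const.mul hv.contDiff)
  posSemidef := fun p hp => by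
    rw [complexHessian_add (contDiff_const.mul hw.contDiff) (contDiff_const.mul hv.contDiff),
      complexHessian_const_mul _ hw.contDiff, complexHessian_const_mul _ hv.contDiff]
    exact ((hw.posSemidef p hp).smul (Complex.zero_le_real.2 (sub_nonneg.2 h1))).add
      ((hv.posSemidef p hp).smul (Complex.zero_le_real.2 h0))
  bound := fun p hp => by
    have hv_le := abs_le.1 (hv.bound p hp)
    have hw_le := abs_le.1 (hw.bound p hp)
    rw [abs_le]
    constructor <;> nlinarith

theorem complexHessian_segment (hv : ContDiff ℝ ∞ v) (hw : ContDiff ℝ ∞ w) (t : ℝ) (p : Cn n) :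
    complexHessian (fun p => (1 - t) * w p + t * v p) p =
      complexHessian w p + (t : ℂ) • complexHessian (fun p => v p - w p) p := by
  have sub_eq : (fun p => v p - w p) = fun p => v p + (-1) * w p := by funext p; ring
  rw [sub_eq, complexHessian_add (contDiff_const.mul hw) (contDiff_const.mul hv),
    complexHessian_add hv (contDiff_const.mul hw), complexHessian_const_mul _ hw,
    complexHessian_const_mul _ hv, complexHessian_const_mul _ hw]
  push_cast
  module

theorem norm_integral_mul_det_sub_le {m b C : ℝ} (hm : 0 ≤ m) (hb0 : 0 ≤ b)
    (hf : ContDiff ℝ ∞ f) (hfc : HasCompactSupport f) (hfV : tsupport f ⊆ V)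
    (hb : ∀ p i j, ‖complexHessian f p i j‖ ≤ b)
    (hC : ∀ u, IsSmoothPSH V M u → ∫ p in tsupport f, adjugateTrace id u p ≤ C)
    (hv : IsSmoothPSH V M v) (hw : IsSmoothPSH V M w) (hvw : ∀ p ∈ V, |v p - w p| ≤ m) :
    ‖(∫ p, (f p : ℂ) * (complexHessian v p).det) - ∫ p, (f p : ℂ) * (complexHessian w p).det‖ ≤
      m * ((n : ℝ) ^ 2 * b) * C := by
  let g : ℝ → ℂ := fun s => ∫ p, (f p : ℂ) *
    (complexHessian w p + (s : ℂ) • complexHessian (fun p => v p - w p) p).det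
  have smooth_sub : ContDiff ℝ ∞ fun p => v p - w p := hv.contDiff.sub hw.contDiff
  have g_one : g 1 = ∫ p, (f p : ℂ) * (complexHessian v p).det := by
    simp only [g, ← complexHessian_segment hv.contDiff hw.contDiff]
    simp
  have g_zero : g 0 = ∫ p, (f p : ℂ) * (complexHessian w p).det := by simp [g]
  have g_deriv := fun t => hasDerivAt_integral_mul_det_add_smul hf.continuous hfc
    (continuous_complexHessian hw.contDiff) (continuous_complexHessian smooth_sub) t
  rw [← g_one, ← g_zero]
  refine norm_image_sub_le_of_norm_deriv_le_segment_01'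
    (fun t _ => (g_deriv t).hasDerivWithinAt) fun t ht => ?_
  have segment := hv.segment hw ht.1 ht.2.le
  have deriv_le := norm_integral_trace_adjugate_le (id : Fin n → Fin n) segment smooth_sub hvw hf
    hfc hfV hb
  simp only [subHessian, Matrix.submatrix_id_id, complexHessian_segment hv.contDiff hw.contDiff,
    Fintype.card_fin] at deriv_le
  exact deriv_le.trans (mul_le_mul_of_nonneg_left (hC _ segment) (by positivity))

theorem exists_abs_integral_sub_le_mul (hV : IsOpen V) (M : ℝ) (hf : ContDiff ℝ ∞ f)
    (hfc : HasCompactSupport f) (hfV : tsupport f ⊆ V) :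
    ∃ C : ℝ, 0 ≤ C ∧ ∀ v w m, IsSmoothPSH V M v → IsSmoothPSH V M w → 0 ≤ m →
      (∀ p ∈ V, |v p - w p| ≤ m) →
      |(∫ p, f p * mongeAmpereDensity v p) - ∫ p, f p * mongeAmpereDensity w p| ≤ C * m := by
  obtain ⟨b, hb0, hb⟩ := exists_norm_complexHessian_le hf hfc
  obtain ⟨C, hC0, hC⟩ :=
    exists_setIntegral_adjugateTrace_le hV M (id : Fin n → Fin n) hfc.isCompact hfV
  refine ⟨(4 : ℝ) ^ n * (n.factorial : ℝ) * ((n : ℝ) ^ 2 * b * C), by positivity,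
    fun v w m hv hw hm hvw => ?_⟩
  have const_nonneg : (0 : ℝ) ≤ 4 ^ n * (n.factorial : ℝ) := by positivity
  rw [integral_mul_mongeAmpereDensity hf.continuous hfc hv.contDiff,
    integral_mul_mongeAmpereDensity hf.continuous hfc hw.contDiff, ← mul_sub, abs_mul,
    abs_of_nonneg const_nonneg, ← Complex.sub_re, mul_assoc _ _ m]
  refine mul_le_mul_of_nonneg_left (((Complex.abs_re_le_norm _).trans
    (norm_integral_mul_det_sub_le hm hb0 hf hfc hfV hb hC hv hw hvw)).trans_eq ?_) const_nonneg
  ring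

theorem mongeAmpereDensity_nonneg {p : Cn n} (h : (complexHessian v p).PosSemidef) :
    0 ≤ mongeAmpereDensity v p :=
  mul_nonneg (by positivity) (Complex.nonneg_iff.1 h.det_nonneg).1

theorem exists_setIntegral_mongeAmpereDensity_le (hV : IsOpen V) (M : ℝ) (hK : IsCompact K)
    (hKV : K ⊆ V) :
    ∃ C : ℝ, 0 ≤ C ∧ ∀ v, IsSmoothPSH V M v → ∫ p in K, mongeAmpereDensity v p ≤ C := by
  obtain ⟨C, hC0, hC⟩ := exists_setIntegral_det_subHessian_le hV M n id K hK hKV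
  refine ⟨(4 : ℝ) ^ n * (n.factorial : ℝ) * C, by positivity, fun v hv => ?_⟩
  simp only [mongeAmpereDensity]
  rw [integral_const_mul]
  exact mul_le_mul_of_nonneg_left (hC v hv) (by positivity)

theorem abs_integral_mul_mongeAmpereDensity_le {η : ℝ} (hK : IsCompact K) (hKV : K ⊆ V)
    (hf : ∀ p, |f p| ≤ η) (hfK : ∀ p ∉ K, f p = 0) (hv : IsSmoothPSH V M v) :
    |∫ p, f p * mongeAmpereDensity v p| ≤ η * ∫ p in K, mongeAmpereDensity v p := by
  rw [← setIntegral_eq_integral_of_forall_compl_eq_zero (s := K)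
    (fun p hp => by rw [hfK p hp, zero_mul]), ← integral_const_mul, ← Real.norm_eq_abs]
  refine norm_integral_le_of_norm_le
    (((continuous_mongeAmpereDensity hv.contDiff).continuousOn.integrableOn_compact hK).const_mul _)
    ((ae_restrict_iff' hK.measurableSet).2 (Eventually.of_forall fun p hp => ?_))
  have density_nonneg := mongeAmpereDensity_nonneg (hv.posSemidef p (hKV hp))
  rw [norm_mul, Real.norm_of_nonneg density_nonneg]
  exact mul_le_mul_of_nonneg_right (hf p) density_nonneg

theorem exists_smooth_approx_integral (hV : IsOpen V) (M : ℝ) (hf : Continuous f)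
    (hfc : HasCompactSupport f) (hfV : tsupport f ⊆ V) {ε : ℝ} (hε : 0 < ε) :
    ∃ g : Cn n → ℝ, ContDiff ℝ ∞ g ∧ HasCompactSupport g ∧ tsupport g ⊆ V ∧
      ∀ v, IsSmoothPSH V M v →
        |(∫ p, f p * mongeAmpereDensity v p) - ∫ p, g p * mongeAmpereDensity v p| ≤ ε := by
  obtain ⟨C, hC0, hC⟩ := exists_setIntegral_mongeAmpereDensity_le hV M hfc.isCompact hfV
  have hη : 0 < ε / (C + 1) := by positivity
  obtain ⟨g, hg, hfg, support_subset⟩ :=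
    hf.exists_contDiff_approx ⊤ (ε := fun _ => ε / (C + 1)) continuous_const fun _ => hη
  have tsupport_subset : tsupport g ⊆ tsupport f := closure_mono support_subset
  have hgc : HasCompactSupport g := hfc.mono support_subset
  refine ⟨g, hg, hgc, tsupport_subset.trans hfV, fun v hv => ?_⟩
  rw [← integral_sub (integrable_mul_mongeAmpereDensity hf hfc hv.contDiff)
    (integrable_mul_mongeAmpereDensity hg.continuous hgc hv.contDiff)]
  simp only [← sub_mul]
  calc |∫ p, (f p - g p) * mongeAmpereDensity v p|
      ≤ ε / (C + 1) * ∫ p in tsupport f, mongeAmpereDensity v p :=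
        abs_integral_mul_mongeAmpereDensity_le hfc.isCompact hfV
          (fun p => (abs_sub_comm _ _).trans_le (hfg p).le)
          (fun p hp => by rw [image_eq_zero_of_notMem_tsupport hp,
            image_eq_zero_of_notMem_tsupport fun h => hp (tsupport_subset h), sub_zero]) hv
    _ ≤ ε / (C + 1) * (C + 1) :=
        mul_le_mul_of_nonneg_left ((hC v hv).trans (by linarith)) hη.le
    _ = ε := by field_simp

theorem exists_forall_abs_integral_sub_le (hV : IsOpen V) (M : ℝ) (hf : Continuous f)
    (hfc : HasCompactSupport f) (hfV : tsupport f ⊆ V) {ε : ℝ} (hε : 0 < ε) :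
    ∃ δ : ℝ, 0 < δ ∧ ∀ v w, IsSmoothPSH V M v → IsSmoothPSH V M w →
      (∀ p ∈ V, |v p - w p| ≤ δ) →
      |(∫ p, f p * mongeAmpereDensity v p) - ∫ p, f p * mongeAmpereDensity w p| ≤ ε := by
  obtain ⟨g, hg, hgc, hgV, approx⟩ :=
    exists_smooth_approx_integral hV M hf hfc hfV (show 0 < ε / 4 by positivity)
  obtain ⟨C, hC0, hC⟩ := exists_abs_integral_sub_le_mul hV M hg hgc hgV
  refine ⟨ε / (2 * (C + 1)), by positivity, fun v w hv hw hvw => ?_⟩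
  have smooth_le : C * (ε / (2 * (C + 1))) ≤ ε / 2 := by
    rw [mul_div_assoc', div_le_div_iff₀ (by positivity) (by positivity)]
    nlinarith
  have approx_v := abs_le.1 (approx v hv)
  have approx_w := abs_le.1 (approx w hw)
  have stable := abs_le.1 ((hC v w _ hv hw (by positivity) hvw).trans smooth_le)
  rw [abs_le]
  constructor <;> linarith [approx_v.1, approx_v.2, approx_w.1, approx_w.2, stable.1, stable.2]

end Stability

/-! ### The complex Hessian of a smooth plurisubharmonic function -/

noncomputable section LeviForm

open scoped ComplexOrder

theorem isLittleO_taylor_two {E F : Type*} [NormedAddCommGroup E] [NormedSpace ℝ E]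
    [NormedAddCommGroup F] [NormedSpace ℝ F] {u : E → F} (hu : ContDiff ℝ 2 u) (p : E) :
    (fun h => u (p + h) - u p - fderiv ℝ u p h - (1 / 2 : ℝ) • fderiv ℝ (fderiv ℝ u) p h h)
      =o[𝓝 0] fun h => ‖h‖ ^ 2 := by
  let B := fderiv ℝ (fderiv ℝ u) p
  let R : E → F := fun h => u (p + h) - u p - fderiv ℝ u p h - (1 / 2 : ℝ) • B h h
  have fderiv_B : HasFDerivAt (fderiv ℝ u) B p :=
    ((hu.fderiv_right (m := 1) le_rfl).differentiable one_ne_zero p).hasFDerivAt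
  have fderiv_quadratic : ∀ x, HasFDerivAt (fun h => (1 / 2 : ℝ) • B h h) (B x) x := fun x => by
    refine (((B.hasFDerivAt (x := x)).clm_apply (hasFDerivAt_id x)).const_smul
      (1 / 2 : ℝ)).congr_fderiv (ContinuousLinearMap.ext fun y => ?_)
    simp only [id_eq, smul_apply, add_apply, ContinuousLinearMap.comp_apply,
      ContinuousLinearMap.flip_apply, ContinuousLinearMap.id_apply, B, fderiv_fderiv_comm hu p y x]
    module
  have fderiv_R : ∀ x, HasFDerivAt R (fderiv ℝ u (p + x) - fderiv ℝ u p - B x) x := fun x =>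
    ((((hu.differentiable two_ne_zero (p + x)).hasFDerivAt.comp x
      ((hasFDerivAt_id x).const_add p)).sub_const _).sub
        (fderiv ℝ u p).hasFDerivAt).sub (fderiv_quadratic x)
  refine Asymptotics.isLittleO_iff.2 fun ε hε => ?_
  obtain ⟨δ, hδ, fderiv_R_le⟩ :=
    Metric.eventually_nhds_iff.1 ((hasFDerivAt_iff_isLittleO_nhds_zero.1 fderiv_B).def hε)
  filter_upwards [Metric.ball_mem_nhds 0 hδ] with h hh
  have mean_value := (convex_closedBall (0 : E) ‖h‖).norm_image_sub_le_of_norm_hasFDerivWithin_le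
    (f := R) (C := ε * ‖h‖) (x := 0) (y := h) (fun x _ => (fderiv_R x).hasFDerivWithinAt)
    (fun x hx => ?_) (by simp) (by simp)
  · have R_zero : R 0 = 0 := by simp [R]
    rw [R_zero, sub_zero, sub_zero, mul_assoc, ← sq] at mean_value
    rwa [Real.norm_of_nonneg (sq_nonneg ‖h‖)]
  · rw [mem_closedBall_zero_iff] at hx
    exact (fderiv_R_le (by simpa using hx.trans_lt (mem_ball_zero_iff.1 hh))).trans
      (mul_le_mul_of_nonneg_left hx hε.le)

theorem eventually_apply_add_apply_neg_le {E : Type*} [NormedAddCommGroup E] [NormedSpace ℝ E]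
    {u : E → ℝ} (hu : ContDiff ℝ 2 u) (p : E) {ε : ℝ} (hε : 0 < ε) :
    ∀ᶠ h in 𝓝 (0 : E),
      u (p + h) + u (p + -h) ≤ 2 * u p + fderiv ℝ (fderiv ℝ u) p h h + ε * ‖h‖ ^ 2 := by
  have taylor := (isLittleO_taylor_two hu p).def (half_pos hε)
  have taylor_neg := (continuous_neg.tendsto' (0 : E) 0 neg_zero).eventually taylor
  filter_upwards [taylor, taylor_neg] with h le le_neg
  rw [Real.norm_of_nonneg (sq_nonneg _)] at le le_neg
  simp only [map_neg, neg_apply, neg_neg, norm_neg, smul_eq_mul] at le le_neg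
  linarith [(abs_le.1 le).2, (abs_le.1 le_neg).2]

section BilinearForm

variable {E : Type*} [NormedAddCommGroup E] [NormedSpace ℂ E]

theorem complex_smul_eq (c : ℂ) (v : E) : c • v = c.re • v + c.im • Complex.I • v := by
  nth_rw 1 [← Complex.re_add_im c]
  rw [add_smul, mul_smul, Complex.coe_smul, Complex.coe_smul]

theorem I_smul_complex_smul_eq (c : ℂ) (v : E) :
    Complex.I • c • v = (-c.im) • v + c.re • Complex.I • v := by
  rw [smul_smul, complex_smul_eq, Complex.I_mul_re, Complex.I_mul_im]

variable (B : E →L[ℝ] E →L[ℝ] ℝ)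

theorem apply_complex_smul_self_add {B : E →L[ℝ] E →L[ℝ] ℝ} (hB : ∀ v w, B v w = B w v) (c : ℂ)
    (v : E) : B (c • v) (c • v) + B (Complex.I • c • v) (Complex.I • c • v) =
      ‖c‖ ^ 2 * (B v v + B (Complex.I • v) (Complex.I • v)) := by
  rw [I_smul_complex_smul_eq, complex_smul_eq, ← Complex.normSq_eq_norm_sq, Complex.normSq_apply]
  simp only [map_add, map_smul, add_apply, smul_apply, smul_eq_mul, hB (Complex.I • v) v]
  ring

/-- The sesquilinear form of type `(1, 1)` associated with a real bilinear form: if `B` is the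
second derivative of `u`, it is the Levi form `∑ (∂²u/∂z_j∂z̄_k) v_j w̄_k` of `u`. -/
def leviForm : E →ₗ[ℂ] E →ₛₗ[starRingEnd ℂ] ℂ :=
  LinearMap.mk₂'ₛₗ (RingHom.id ℂ) (starRingEnd ℂ)
    (fun v w => (1 / 4 : ℂ) * (B v w + Complex.I * B v (Complex.I • w) -
      Complex.I * B (Complex.I • v) w + B (Complex.I • v) (Complex.I • w)))
    (fun v₁ v₂ w => by simp only [smul_add, map_add, add_apply]; push_cast; ring)
    (fun c v w => by
      rw [I_smul_complex_smul_eq c v, complex_smul_eq c v]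
      apply Complex.ext <;> simp <;> ring)
    (fun v w₁ w₂ => by simp only [smul_add, map_add]; push_cast; ring)
    (fun c v w => by
      rw [I_smul_complex_smul_eq c w, complex_smul_eq c w]
      apply Complex.ext <;> simp <;> ring)

theorem leviForm_apply (v w : E) : leviForm B v w =
    (1 / 4 : ℂ) * (B v w + Complex.I * B v (Complex.I • w) -
      Complex.I * B (Complex.I • v) w + B (Complex.I • v) (Complex.I • w)) := rfl

theorem leviForm_apply_self {B : E →L[ℝ] E →L[ℝ] ℝ} (hB : ∀ v w, B v w = B w v) (v : E) :
    leviForm B v v = ((1 / 4 * (B v v + B (Complex.I • v) (Complex.I • v)) : ℝ) : ℂ) := by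
  rw [leviForm_apply, hB (Complex.I • v) v]
  push_cast
  ring

theorem conj_leviForm {B : E →L[ℝ] E →L[ℝ] ℝ} (hB : ∀ v w, B v w = B w v) (v w : E) :
    (starRingEnd ℂ) (leviForm B v w) = leviForm B w v := by
  rw [leviForm_apply, leviForm_apply, hB w, hB w, hB (Complex.I • w), hB (Complex.I • w)]
  simp only [map_mul, map_add, map_sub, map_div₀, map_one, map_ofNat, Complex.conj_I,
    Complex.conj_ofReal]
  ring

end BilinearForm

variable {n : ℕ} {V : Set (Cn n)} {u : Cn n → ℝ}

theorem IsPSH.four_mul_le (hu : IsPSH V u) {a b : Cn n} {m : ℝ}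
    (hV : ∀ ζ : ℂ, ‖ζ‖ ≤ 1 → a + ζ • b ∈ V)
    (hm : ∀ ζ : ℂ, ‖ζ‖ = 1 → u (a + ζ • b) + u (a + -(ζ • b)) +
      (u (a + Complex.I • ζ • b) + u (a + -(Complex.I • ζ • b))) ≤ m) :
    4 * u a ≤ m := by
  have rotate : ∀ c : ℂ, ‖c‖ = 1 → CircleIntegrable (fun ζ : ℂ => u (a + ζ • c • b)) 0 1 ∧
      u a ≤ Real.circleAverage (fun ζ : ℂ => u (a + ζ • c • b)) 0 1 := fun c hc =>
    hu.subMean a (c • b) fun ζ hζ => by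
      rw [smul_smul]
      exact hV _ (by rwa [norm_mul, hc, mul_one])
  obtain ⟨int₁, le₁⟩ := rotate 1 norm_one
  obtain ⟨int₂, le₂⟩ := rotate (-1) (by rw [norm_neg, norm_one])
  obtain ⟨int₃, le₃⟩ := rotate Complex.I Complex.norm_I
  obtain ⟨int₄, le₄⟩ := rotate (-Complex.I) (by rw [norm_neg, Complex.norm_I])
  refine le_trans ?_ (Real.circleAverage_mono_on_of_le_circle
    ((int₁.add int₂).add (int₃.add int₄)) fun ζ hζ => ?_)
  · rw [Real.circleAverage_add (int₁.add int₂) (int₃.add int₄), Real.circleAverage_add int₁ int₂,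
      Real.circleAverage_add int₃ int₄]
    linarith
  · simpa only [Pi.add_apply, one_smul, neg_smul, smul_neg, smul_comm ζ Complex.I b] using
      hm ζ (by simpa using hζ)

theorem IsPSH.fderiv_fderiv_add_nonneg (hpsh : IsPSH V u) (hV : IsOpen V) (hu : ContDiff ℝ 2 u)
    {p : Cn n} (hp : p ∈ V) (b : Cn n) :
    0 ≤ fderiv ℝ (fderiv ℝ u) p b b +
      fderiv ℝ (fderiv ℝ u) p (Complex.I • b) (Complex.I • b) := by
  set B := fderiv ℝ (fderiv ℝ u) p
  refine le_of_forall_pos_le_add fun ε hε => ?_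
  obtain ⟨η, hη, hηε⟩ := exists_pos_mul_lt hε (2 * ‖b‖ ^ 2)
  have mem : ∀ᶠ h in 𝓝 (0 : Cn n), p + h ∈ V :=
    (continuous_const_add p).continuousAt.eventually_mem (by rw [add_zero]; exact hV.mem_nhds hp)
  obtain ⟨δ, hδ, near⟩ := Metric.eventually_nhds_iff.1
    (mem.and (eventually_apply_add_apply_neg_le hu p hη))
  obtain ⟨r, hr, hrδ⟩ := exists_pos_mul_lt hδ ‖b‖
  have near_of_norm_le : ∀ c : ℂ, ‖c‖ ≤ r → p + c • b ∈ V ∧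
      u (p + c • b) + u (p + -(c • b)) ≤ 2 * u p + B (c • b) (c • b) + η * ‖c • b‖ ^ 2 :=
    fun c hc => near <| by
      rw [dist_zero_right, norm_smul, mul_comm]
      exact (mul_le_mul_of_nonneg_left hc (norm_nonneg b)).trans_lt hrδ
  have norm_mul_r : ∀ ζ : ℂ, ‖ζ * r‖ = ‖ζ‖ * r := fun ζ => by
    rw [norm_mul, Complex.norm_real, Real.norm_of_nonneg hr.le]
  have four_mul_le : 4 * u p ≤ 4 * u p +
      r ^ 2 * (B b b + B (Complex.I • b) (Complex.I • b) + η * (2 * ‖b‖ ^ 2)) := by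
    refine hpsh.four_mul_le (b := (r : ℂ) • b) (fun ζ hζ => ?_) fun ζ hζ => ?_
    · rw [smul_smul]
      exact (near_of_norm_le _ (by rw [norm_mul_r]; exact mul_le_of_le_one_left hr.le hζ)).1
    · have norm_c : ‖ζ * r‖ = r := by rw [norm_mul_r, hζ, one_mul]
      have norm_I_c : ‖Complex.I * (ζ * r)‖ = r := by rw [norm_mul, Complex.norm_I, one_mul, norm_c]
      have second_difference := (near_of_norm_le _ norm_c.le).2
      have second_difference_I := (near_of_norm_le _ norm_I_c.le).2
      have rotation := apply_complex_smul_self_add (fderiv_fderiv_comm hu p) (ζ * r) b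
      rw [norm_smul, norm_c] at second_difference
      rw [norm_smul, norm_I_c, mul_smul Complex.I] at second_difference_I
      rw [norm_c] at rotation
      rw [smul_smul]
      linarith
  have sum_nonneg := nonneg_of_mul_nonneg_right ((le_add_iff_nonneg_right _).1 four_mul_le)
    (by positivity)
  linarith

theorem complexHessian_eq_leviForm (hu : ContDiff ℝ ∞ u) (p : Cn n) (j k : Fin n) :
    complexHessian u p j k = leviForm (fderiv ℝ (fderiv ℝ u) p) (stdVec j) (stdVec k) := by
  have hasFDerivAt_ofReal : ∀ q, HasFDerivAt (smoothOfReal u hu : Cn n → ℂ)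
      (Complex.ofRealCLM ∘L fderiv ℝ u q) q := fun q =>
    Complex.ofRealCLM.hasFDerivAt.comp q (hu.differentiable (by simp) q).hasFDerivAt
  have dirDeriv_ofReal : ∀ v w, (dirDeriv v (dirDeriv w (smoothOfReal u hu)) : Cn n → ℂ) p =
      (fderiv ℝ (fderiv ℝ u) p v w : ℝ) := fun v w => by
    have hasFDerivAt_fderiv : HasFDerivAt (fderiv ℝ u) (fderiv ℝ (fderiv ℝ u) p) p :=
      (((hu.of_le ENat.LEInfty.out).fderiv_right (m := 1) (n := 2) le_rfl).differentiable
        one_ne_zero p).hasFDerivAt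
    rw [dirDeriv_dirDeriv_apply, funext fun q => (hasFDerivAt_ofReal q).fderiv]
    exact congrArg (· v w) ((ContinuousLinearMap.compL ℝ (Cn n) ℝ ℂ
      Complex.ofRealCLM).hasFDerivAt.comp p hasFDerivAt_fderiv).fderiv
  have expand : wirtingerDerivation j (wirtingerBarDerivation k (smoothOfReal u hu)) =
      (1 / 4 : ℂ) • (dirDeriv (stdVec j) (dirDeriv (stdVec k) (smoothOfReal u hu)) +
        Complex.I • dirDeriv (stdVec j) (dirDeriv (Complex.I • stdVec k) (smoothOfReal u hu)) -
        Complex.I • dirDeriv (Complex.I • stdVec j) (dirDeriv (stdVec k) (smoothOfReal u hu)) +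
        dirDeriv (Complex.I • stdVec j) (dirDeriv (Complex.I • stdVec k) (smoothOfReal u hu))) := by
    simp only [wirtingerDerivation, wirtingerBarDerivation, Derivation.smul_apply,
      Derivation.add_apply, Derivation.map_smul, Derivation.map_add]
    match_scalars <;> first | ring1 | linear_combination (-1 / 4 : ℂ) * Complex.I_mul_I
  rw [complexHessian_apply hu, expand, leviForm_apply]
  simp only [← dirDeriv_ofReal]
  rfl

theorem IsPSH.posSemidef_complexHessian (hpsh : IsPSH V u) (hV : IsOpen V) (hu : ContDiff ℝ ∞ u)
    {p : Cn n} (hp : p ∈ V) : (complexHessian u p).PosSemidef := by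
  have hu₂ : ContDiff ℝ 2 u := hu.of_le ENat.LEInfty.out
  rw [Matrix.posSemidef_iff_dotProduct_mulVec]
  refine ⟨Matrix.ext fun j k => ?_, fun x => ?_⟩
  · rw [Matrix.conjTranspose_apply, complexHessian_eq_leviForm hu, complexHessian_eq_leviForm hu]
    exact conj_leviForm (fderiv_fderiv_comm hu₂ p) _ _
  · let b : Cn n := ∑ j, (starRingEnd ℂ) (x j) • stdVec j
    have quadratic_form : star x ⬝ᵥ (complexHessian u p).mulVec x =
        leviForm (fderiv ℝ (fderiv ℝ u) p) b b := by
      simp only [b, map_sum, LinearMap.sum_apply, LinearMap.map_smulₛₗ, LinearMap.smul_apply,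
        RingHom.id_apply, Complex.conj_conj, smul_eq_mul, dotProduct, Matrix.mulVec,
        complexHessian_eq_leviForm hu, Pi.star_apply, Complex.star_def, Finset.mul_sum]
      rw [Finset.sum_comm]
      exact Finset.sum_congr rfl fun j _ => Finset.sum_congr rfl fun k _ => by ring
    rw [quadratic_form, leviForm_apply_self (fderiv_fderiv_comm hu₂ p)]
    exact Complex.zero_le_real.2
      (mul_nonneg (by norm_num) (hpsh.fderiv_fderiv_add_nonneg hV hu₂ hp b))

end LeviForm

/-! ### Mollification -/

noncomputable section Mollification

variable {n : ℕ}

/-- The approximate identity on `ℂⁿ` used for regularisation: smooth bumps supported in the balls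
of radius `1 / (i + 1)`. -/
def stdBump (n i : ℕ) : ContDiffBump (0 : Cn n) where
  rIn := 1 / (2 * ((i : ℝ) + 1))
  rOut := 1 / ((i : ℝ) + 1)
  rIn_pos := by positivity
  rIn_lt_rOut := by
    apply one_div_lt_one_div_of_lt <;> nlinarith [(Nat.cast_nonneg i : (0 : ℝ) ≤ i)]

/-- The `i`-th regularisation of a function on `ℂⁿ`, its convolution with a normalised bump. -/
def mollify (i : ℕ) (g : Cn n → ℝ) : Cn n → ℝ :=
  convolution ((stdBump n i).normed volume) g (ContinuousLinearMap.lsmul ℝ ℝ) volume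

theorem mollify_apply (i : ℕ) (g : Cn n → ℝ) (x : Cn n) :
    mollify i g x = ∫ t, (stdBump n i).normed volume t * g (x - t) := rfl

theorem abs_mollify_le (i : ℕ) {g : Cn n → ℝ} {M : ℝ} (hM : ∀ x, |g x| ≤ M) (x : Cn n) :
    |mollify i g x| ≤ M := by
  have integral_mul_bound : ∫ t, (stdBump n i).normed volume t * M = M := by
    rw [integral_mul_const, (stdBump n i).integral_normed, one_mul]
  rw [mollify_apply, ← Real.norm_eq_abs]
  refine (norm_integral_le_of_norm_le ((stdBump n i).integrable_normed.mul_const M)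
    (Eventually.of_forall fun t => ?_)).trans integral_mul_bound.le
  rw [norm_mul, Real.norm_of_nonneg ((stdBump n i).nonneg_normed t)]
  exact mul_le_mul_of_nonneg_left (hM _) ((stdBump n i).nonneg_normed t)

section Measurable

variable (i : ℕ) {g : Cn n → ℝ} (hg : Measurable g) {M : ℝ} (hM : ∀ x, |g x| ≤ M)

include hg hM

theorem integrable_mollify_integrand (x : Cn n) :
    Integrable fun t => (stdBump n i).normed volume t * g (x - t) :=
  (stdBump n i).integrable_normed.mul_bdd (c := M)
    (hg.comp (measurable_const.sub measurable_id)).aestronglyMeasurable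
    (Eventually.of_forall fun _ => hM _)

theorem contDiff_mollify : ContDiff ℝ ∞ (mollify i g) :=
  HasCompactSupport.contDiff_convolution_left (n := ⊤) _
    (stdBump n i).hasCompactSupport_normed (stdBump n i).contDiff_normed <|
    locallyIntegrable_iff.2 fun _ hK => Measure.integrableOn_of_bounded hK.measure_lt_top.ne
      hg.aestronglyMeasurable (Eventually.of_forall hM)

theorem mollify_add {h : Cn n → ℝ} (hh : Measurable h) {M' : ℝ} (hM' : ∀ x, |h x| ≤ M')
    (x : Cn n) : mollify i (fun x => g x + h x) x = mollify i g x + mollify i h x := by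
  simp only [mollify_apply, mul_add]
  exact integral_add (integrable_mollify_integrand i hg hM x)
    (integrable_mollify_integrand i hh hM' x)

theorem integrable_mollify_integrand_circleMap (a b : Cn n) :
    Integrable (fun q : ℝ × Cn n =>
        (stdBump n i).normed volume q.2 * g (a - q.2 + circleMap 0 1 q.1 • b))
      ((volume.restrict (uIoc 0 (2 * Real.pi))).prod volume) := by
  have continuous_translate :
      Continuous fun q : ℝ × Cn n => a - q.2 + circleMap 0 1 q.1 • b := by
    have := continuous_circleMap 0 1
    fun_prop
  have : IsFiniteMeasure ((volume : Measure ℝ).restrict (uIoc 0 (2 * Real.pi))) := by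
    rw [uIoc_of_le Real.two_pi_pos.le]
    infer_instance
  exact (Integrable.comp_snd (stdBump n i).integrable_normed _).mul_bdd (c := M)
    (hg.comp continuous_translate.measurable).aestronglyMeasurable
    (Eventually.of_forall fun _ => hM _)

theorem integrable_mul_circleAverage (a b : Cn n) :
    Integrable fun t => (stdBump n i).normed volume t *
      Real.circleAverage (fun ζ : ℂ => g (a - t + ζ • b)) 0 1 := by
  refine ((integrable_mollify_integrand_circleMap i hg hM a b).integral_prod_right.const_mul
    (2 * Real.pi)⁻¹).congr (Eventually.of_forall fun t => ?_)
  dsimp only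
  rw [uIoc_of_le Real.two_pi_pos.le, ← intervalIntegral.integral_of_le Real.two_pi_pos.le,
    intervalIntegral.integral_const_mul, Real.circleAverage_def, smul_eq_mul, mul_left_comm]

theorem circleAverage_mollify (a b : Cn n) :
    Real.circleAverage (fun ζ : ℂ => mollify i g (a + ζ • b)) 0 1 =
      ∫ t, (stdBump n i).normed volume t *
        Real.circleAverage (fun ζ : ℂ => g (a - t + ζ • b)) 0 1 := by
  simp only [Real.circleAverage_def, smul_eq_mul, mollify_apply, add_sub_right_comm a _ _]
  rw [intervalIntegral_integral_swap (integrable_mollify_integrand_circleMap i hg hM a b),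
    ← integral_const_mul]
  refine integral_congr_ae (Eventually.of_forall fun t => ?_)
  dsimp only
  rw [intervalIntegral.integral_const_mul, mul_left_comm]

end Measurable

theorem tendsto_stdBump_rOut : Tendsto (fun i => (stdBump n i).rOut) atTop (𝓝 0) :=
  tendsto_one_div_add_atTop_nhds_zero_nat

theorem tendstoUniformlyOn_mollify {g : Cn n → ℝ} (hg : Measurable g) {D K : Set (Cn n)}
    (hD : IsOpen D) (hgD : ContinuousOn g D) (hK : IsCompact K) (hKD : K ⊆ D) :
    TendstoUniformlyOn (fun i => mollify i g) g atTop K := by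
  refine Metric.tendstoUniformlyOn_iff.2 fun ε hε => ?_
  obtain ⟨δ, hδ, hKδ⟩ := hK.exists_cthickening_subset_open hD hKD
  obtain ⟨δ', hδ', uniform⟩ := Metric.uniformContinuousOn_iff_le.1
    ((hK.cthickening (r := δ)).uniformContinuousOn_of_continuous (hgD.mono hKδ)) (ε / 2)
    (half_pos hε)
  filter_upwards [tendsto_stdBump_rOut.eventually (gt_mem_nhds (lt_min hδ hδ'))] with i hi x hx
  rw [dist_comm]
  refine (ContDiffBump.dist_normed_convolution_le (φ := stdBump n i) (x₀ := x) (ε := ε / 2)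
    hg.aestronglyMeasurable fun y hy => ?_).trans_lt (half_lt_self hε)
  have dist_lt : dist y x < min δ δ' := lt_trans (Metric.mem_ball.1 hy) hi
  exact uniform y
    (Metric.mem_cthickening_of_dist_le y x δ K hx (dist_lt.le.trans (min_le_left _ _))) x
    (Metric.self_subset_cthickening K hx) (dist_lt.le.trans (min_le_right _ _))

theorem IsPSH.isPSH_mollify {D V : Set (Cn n)} {g : Cn n → ℝ} (hpsh : IsPSH D g)
    (hg : Measurable g) {M : ℝ} (hM : ∀ x, |g x| ≤ M) {i : ℕ}
    (hV : ∀ x ∈ V, Metric.ball x (stdBump n i).rOut ⊆ D) : IsPSH V (mollify i g) := by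
  have hcont : Continuous (mollify i g) := (contDiff_mollify i hg hM).continuous
  refine ⟨hcont.upperSemicontinuous.upperSemicontinuousOn _, fun a b hab => ⟨?_, ?_⟩⟩
  · exact (hcont.comp (continuous_const.add
      (continuous_id.smul continuous_const))).continuousOn.circleIntegrable zero_le_one
  rw [circleAverage_mollify i hg hM, mollify_apply]
  refine integral_mono (integrable_mollify_integrand i hg hM a)
    (integrable_mul_circleAverage i hg hM a b) fun t => ?_
  by_cases ht : t ∈ Function.support ((stdBump n i).normed (volume : Measure (Cn n)))
  · refine mul_le_mul_of_nonneg_left (hpsh.subMean (a - t) b fun ζ hζ => ?_).2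
      ((stdBump n i).nonneg_normed t)
    rw [ContDiffBump.support_normed_eq] at ht
    refine hV _ (hab ζ hζ) ?_
    rw [← add_sub_right_comm, Metric.mem_ball, dist_eq_norm, sub_sub_cancel_left, norm_neg]
    exact mem_ball_zero_iff.1 ht
  · simp only [Function.notMem_support.1 ht, zero_mul, le_refl]

end Mollification

/-! ### Limits of Monge-Ampère masses -/

noncomputable section WeakLimits

variable {n : ℕ} {D V : Set (Cn n)} {M : ℝ} {u v : Cn n → ℝ}

theorem IsPSH.mono (h : IsPSH D u) (hVD : V ⊆ D) : IsPSH V u :=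
  ⟨h.usc.mono hVD, fun a b hab => h.subMean a b fun ζ hζ => hVD (hab ζ hζ)⟩

theorem IsPSH.congr (h : IsPSH D u) (huv : EqOn u v D) : IsPSH D v := by
  refine ⟨fun x hx y hy => ?_, fun a b hab => ?_⟩
  · change v x < y at hy
    rw [← huv hx] at hy
    filter_upwards [h.usc x hx y hy, self_mem_nhdsWithin] with z hz hzD
    rwa [← huv hzD]
  obtain ⟨integrable, le⟩ := h.subMean a b hab
  have eqOn_sphere : EqOn (fun ζ : ℂ => u (a + ζ • b)) (fun ζ : ℂ => v (a + ζ • b))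
      (Metric.sphere 0 |1|) := fun ζ hζ => huv (hab ζ (by simpa using hζ.le))
  have mem : a ∈ D := by simpa using hab 0 (by simp)
  rw [← huv mem, ← Real.circleAverage_congr_sphere eqOn_sphere]
  exact ⟨IntervalIntegrable.congr (fun θ _ => eqOn_sphere (by simp)) integrable, le⟩

theorem IsPSH.add (hu : IsPSH D u) (hv : IsPSH D v) : IsPSH D fun z => u z + v z := by
  refine ⟨hu.usc.add hv.usc, fun a b hab => ?_⟩
  obtain ⟨integrable_u, le_u⟩ := hu.subMean a b hab
  obtain ⟨integrable_v, le_v⟩ := hv.subMean a b hab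
  refine ⟨integrable_u.add integrable_v, ?_⟩
  rw [Real.circleAverage_fun_add integrable_u integrable_v]
  exact add_le_add le_u le_v

theorem isPSH_const (D : Set (Cn n)) (c : ℝ) : IsPSH D fun _ => c :=
  ⟨upperSemicontinuousOn_const, fun _ _ _ => ⟨circleIntegrable_const c 0 1,
    (Real.circleAverage_const c 0 1).ge⟩⟩

/-- `u` is continuous and plurisubharmonic in `D` and bounded there by `M ≥ 0`: the functions whose
Monge-Ampère measures are constructed below. -/
structure IsContPSH (D : Set (Cn n)) (M : ℝ) (u : Cn n → ℝ) : Prop where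
  continuousOn : ContinuousOn u D
  psh : IsPSH D u
  nonneg : 0 ≤ M
  bound : ∀ x ∈ D, |u x| ≤ M

namespace IsContPSH

theorem mono (h : IsContPSH D M u) (hVD : V ⊆ D) : IsContPSH V M u :=
  ⟨h.continuousOn.mono hVD, h.psh.mono hVD, h.nonneg, fun x hx => h.bound x (hVD hx)⟩

variable (hu : IsContPSH D M u) (hD : IsOpen D)

include hu

theorem abs_indicator_le (x : Cn n) : |D.indicator u x| ≤ M := by
  by_cases hx : x ∈ D
  · rw [indicator_of_mem hx]; exact hu.bound x hx
  · rw [indicator_of_notMem hx, abs_zero]; exact hu.nonneg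

include hD

theorem measurable_indicator : Measurable (D.indicator u) := by
  classical
  rw [← Set.piecewise_eq_indicator]
  exact hu.continuousOn.measurable_piecewise continuousOn_const hD.measurableSet

theorem contDiff_mollify (i : ℕ) : ContDiff ℝ ∞ (mollify i (D.indicator u)) :=
  _root_.contDiff_mollify i (hu.measurable_indicator hD) hu.abs_indicator_le

theorem eventually_isPSH_mollify (hV : IsCompact (closure V)) (hVD : closure V ⊆ D) :
    ∀ᶠ i in atTop, IsPSH V (mollify i (D.indicator u)) := by
  obtain ⟨δ, hδ, hKδ⟩ := hV.exists_cthickening_subset_open hD hVD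
  filter_upwards [tendsto_stdBump_rOut.eventually (gt_mem_nhds hδ)] with i hi
  refine (hu.psh.congr (eqOn_indicator (f := u)).symm).isPSH_mollify (hu.measurable_indicator hD)
    hu.abs_indicator_le fun x hx y hy => hKδ ?_
  exact Metric.mem_cthickening_of_dist_le y x δ _ (subset_closure hx)
    ((Metric.mem_ball.1 hy).le.trans hi.le)

theorem eventually_isSmoothPSH_mollify (hV : IsOpen V) (hVc : IsCompact (closure V))
    (hVD : closure V ⊆ D) : ∀ᶠ i in atTop, IsSmoothPSH V M (mollify i (D.indicator u)) := by
  filter_upwards [hu.eventually_isPSH_mollify hD hVc hVD] with i hi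
  exact ⟨hu.contDiff_mollify hD i,
    fun p hp => hi.posSemidef_complexHessian hV (hu.contDiff_mollify hD i) hp,
    fun p _ => abs_mollify_le i hu.abs_indicator_le p⟩

theorem tendstoUniformlyOn_mollify (hVc : IsCompact (closure V)) (hVD : closure V ⊆ D) :
    TendstoUniformlyOn (fun i => mollify i (D.indicator u)) u atTop V :=
  ((_root_.tendstoUniformlyOn_mollify (hu.measurable_indicator hD) hD
    (hu.continuousOn.congr eqOn_indicator) hVc hVD).mono subset_closure).congr_right
      fun _ hx => indicator_of_mem (hVD (subset_closure hx)) u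

end IsContPSH

section Comparison

variable {f : Cn n → ℝ} (hf : Continuous f) (hfc : HasCompactSupport f)

include hf hfc

theorem tendsto_integral_mongeAmpereDensity_sub {ι : Type*} {l : Filter ι} (hV : IsOpen V)
    {v w : ι → Cn n → ℝ} (hv : ∀ᶠ i in l, IsSmoothPSH V M (v i))
    (hw : ∀ᶠ i in l, IsSmoothPSH V M (w i)) (hvu : TendstoUniformlyOn v u l V)
    (hwu : TendstoUniformlyOn w u l V) (hfV : tsupport f ⊆ V) :
    Tendsto (fun i => (∫ p, f p * mongeAmpereDensity (v i) p) -
      ∫ p, f p * mongeAmpereDensity (w i) p) l (𝓝 0) := by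
  rw [Metric.tendsto_nhds]
  intro ε hε
  obtain ⟨δ, hδ, stable⟩ := exists_forall_abs_integral_sub_le hV M hf hfc hfV (half_pos hε)
  filter_upwards [hv, hw, Metric.tendstoUniformlyOn_iff.1 hvu (δ / 2) (half_pos hδ),
    Metric.tendstoUniformlyOn_iff.1 hwu (δ / 2) (half_pos hδ)] with i hvi hwi v_close w_close
  rw [Real.dist_eq, sub_zero]
  refine (stable _ _ hvi hwi fun p hp => ?_).trans_lt (half_lt_self hε)
  rw [← Real.dist_eq]
  linarith [dist_triangle_left (v i p) (w i p) (u p), v_close p hp, w_close p hp]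

theorem cauchySeq_integral_mongeAmpereDensity (hV : IsOpen V) {v : ℕ → Cn n → ℝ}
    (hv : ∀ᶠ i in atTop, IsSmoothPSH V M (v i)) (hvu : TendstoUniformlyOn v u atTop V)
    (hfV : tsupport f ⊆ V) : CauchySeq fun i => ∫ p, f p * mongeAmpereDensity (v i) p := by
  rw [cauchySeq_iff_tendsto_dist_atTop_0, ← prod_atTop_atTop_eq]
  simp only [Real.dist_eq]
  refine (tendsto_zero_iff_abs_tendsto_zero _).1 ?_
  exact tendsto_integral_mongeAmpereDensity_sub hf hfc hV (tendsto_fst.eventually hv)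
    (tendsto_snd.eventually hv) (fun s hs => tendsto_fst.eventually (hvu s hs))
    (fun s hs => tendsto_snd.eventually (hvu s hs)) hfV

end Comparison

theorem exists_cutoff_forall_contDiff_mul {U K : Set (Cn n)} (hU : IsOpen U) (hK : IsCompact K)
    (hKU : K ⊆ U) :
    ∃ χ : Cn n → ℝ, (∀ v : Cn n → ℝ, ContDiffOn ℝ ∞ v U → ContDiff ℝ ∞ fun x => χ x * v x) ∧
      ∀ x ∈ K, χ x = 1 := by
  obtain ⟨χ, hχ, -, hχU, hχK, -⟩ := exists_smooth_cutoff hK hU hKU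
  refine ⟨χ, fun v hv => contDiff_iff_contDiffAt.2 fun x => ?_, hχK⟩
  by_cases hx : x ∈ tsupport χ
  · exact hχ.contDiffAt.mul (hv.contDiffAt (hU.mem_nhds (hχU hx)))
  · refine (contDiffAt_const (c := (0 : ℝ))).congr_of_eventuallyEq ?_
    filter_upwards [notMem_tsupport_iff_eventuallyEq.1 hx] with y hy
    rw [hy, Pi.zero_apply, zero_mul]

theorem eventually_isSmoothPSH_of_tendstoUniformlyOn (hV : IsOpen V) (hM : ∀ x ∈ V, |u x| ≤ M)
    {v : ℕ → Cn n → ℝ} (hv : ∀ i, ContDiff ℝ ∞ (v i)) (hpsh : ∀ i, IsPSH V (v i))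
    (hvu : TendstoUniformlyOn v u atTop V) : ∀ᶠ i in atTop, IsSmoothPSH V (M + 1) (v i) := by
  filter_upwards [Metric.tendstoUniformlyOn_iff.1 hvu 1 one_pos] with i hi
  refine ⟨hv i, fun p hp => (hpsh i).posSemidef_complexHessian hV (hv i) hp, fun p hp => ?_⟩
  have close := hi p hp
  rw [dist_comm, Real.dist_eq] at close
  linarith [hM p hp, abs_sub_abs_le_abs_sub (v i p) (u p)]

namespace IsContPSH

variable (hu : IsContPSH D M u) (hD : IsOpen D) {f : Cn n → ℝ} (hf : Continuous f)
  (hfc : HasCompactSupport f)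

include hu hD hf hfc

theorem exists_tendsto (hfD : tsupport f ⊆ D) :
    ∃ L : ℝ, Tendsto (fun i => ∫ p, f p * mongeAmpereDensity (mollify i (D.indicator u)) p)
      atTop (𝓝 L) := by
  obtain ⟨V, hV, hKV, hVD, hVc⟩ := exists_open_between_and_isCompact_closure hfc.isCompact hD hfD
  exact cauchySeq_tendsto_of_complete (cauchySeq_integral_mongeAmpereDensity hf hfc hV
    (hu.eventually_isSmoothPSH_mollify hD hV hVc hVD) (hu.tendstoUniformlyOn_mollify hD hVc hVD)
    hKV)

theorem tendsto_of_tendstoLocallyUniformlyOn {U : Set (Cn n)} (hU : IsOpen U) (hUD : U ⊆ D)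
    {v : ℕ → Cn n → ℝ} (hpsh : ∀ i, IsPSH U (v i)) (hv : ∀ i, ContDiffOn ℝ ∞ (v i) U)
    (hvu : TendstoLocallyUniformlyOn v u atTop U) (hfU : tsupport f ⊆ U) {L : ℝ}
    (hL : Tendsto (fun i => ∫ p, f p * mongeAmpereDensity (mollify i (D.indicator u)) p)
      atTop (𝓝 L)) :
    Tendsto (fun i => ∫ p, f p * mongeAmpereDensity (v i) p) atTop (𝓝 L) := by
  obtain ⟨V, hV, hKV, hVU, hVc⟩ := exists_open_between_and_isCompact_closure hfc.isCompact hU hfU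
  obtain ⟨χ, hχ, hχ1⟩ := exists_cutoff_forall_contDiff_mul hU hVc hVU
  have hVU' : V ⊆ U := subset_closure.trans hVU
  have eqOn_cutoff : ∀ i, EqOn (v i) (fun x => χ x * v i x) V := fun i x hx => by
    simp only [hχ1 x (subset_closure hx), one_mul]
  have uniform : TendstoUniformlyOn (fun i x => χ x * v i x) u atTop V :=
    (((tendstoLocallyUniformlyOn_iff_forall_isCompact hU).1 hvu _ hVU hVc).mono
      subset_closure).congr (Eventually.of_forall eqOn_cutoff)
  have smooth : ∀ᶠ i in atTop, IsSmoothPSH V (M + 1) fun x => χ x * v i x :=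
    eventually_isSmoothPSH_of_tendstoUniformlyOn hV (fun x hx => hu.bound x (hUD (hVU' hx)))
      (fun i => hχ _ (hv i)) (fun i => ((hpsh i).mono hVU').congr (eqOn_cutoff i)) uniform
  have smooth_mollify : ∀ᶠ i in atTop, IsSmoothPSH V (M + 1) (mollify i (D.indicator u)) :=
    (hu.eventually_isSmoothPSH_mollify hD hV hVc (hVU.trans hUD)).mono fun i hi =>
      ⟨hi.contDiff, hi.posSemidef, fun p hp => (hi.bound p hp).trans (by linarith)⟩
  have masses := (tendsto_integral_mongeAmpereDensity_sub hf hfc hV smooth smooth_mollify uniform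
    (hu.tendstoUniformlyOn_mollify hD hVc (hVU.trans hUD)) hKV).add hL
  simp only [sub_add_cancel, zero_add] at masses
  refine masses.congr fun i => integral_congr_ae (Eventually.of_forall fun p => ?_)
  by_cases hp : p ∈ tsupport f
  · simp only [mongeAmpereDensity_congr
      (eventuallyEq_of_mem (hV.mem_nhds (hKV hp)) (eqOn_cutoff i))]
  · simp only [image_eq_zero_of_notMem_tsupport hp, zero_mul]

end IsContPSH

theorem exists_subseq_antitone_add_const {X : Type*} {F : ℕ → X → ℝ} {g : X → ℝ} {S : Set X}
    (hF : TendstoUniformlyOn F g atTop S) {P : ℕ → Prop} (hP : ∀ᶠ i in atTop, P i) :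
    ∃ (ψ : ℕ → ℕ) (c : ℕ → ℝ), Tendsto ψ atTop atTop ∧ (∀ k, P (ψ k)) ∧
      (∀ x ∈ S, Antitone fun k => F (ψ k) x + c k) ∧
      ∀ x ∈ S, Tendsto (fun k => F (ψ k) x + c k) atTop (𝓝 (g x)) := by
  have exists_close : ∀ k : ℕ, ∃ i, k ≤ i ∧ P i ∧ ∀ x ∈ S, dist (g x) (F i x) < (1 / 2) ^ k :=
    fun k => ((eventually_ge_atTop k).and (hP.and
      (Metric.tendstoUniformlyOn_iff.1 hF _ (by positivity)))).exists
  choose ψ le_ψ hPψ close using exists_close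
  have ψ_tendsto : Tendsto ψ atTop atTop := tendsto_atTop_mono le_ψ tendsto_id
  have const_tendsto : Tendsto (fun k : ℕ => 3 * (1 / 2 : ℝ) ^ k) atTop (𝓝 0) := by
    simpa using (tendsto_pow_atTop_nhds_zero_of_lt_one (r := (1 / 2 : ℝ)) (by norm_num)
      (by norm_num)).const_mul 3
  refine ⟨ψ, fun k => 3 * (1 / 2) ^ k, ψ_tendsto, hPψ, fun x hx => ?_, fun x hx => ?_⟩
  · refine antitone_nat_of_succ_le fun k => ?_
    have close_k := abs_lt.1 (close k x hx)
    have close_succ := abs_lt.1 (close (k + 1) x hx)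
    dsimp only
    rw [pow_succ] at close_succ ⊢
    linarith [close_k.2, close_succ.1]
  · simpa using ((hF.tendsto_at hx).comp ψ_tendsto).add const_tendsto

theorem mongeAmpereDensity_add_const (hu : ContDiff ℝ ∞ u) (c : ℝ) :
    mongeAmpereDensity (fun z => u z + c) = mongeAmpereDensity u := by
  funext p
  simp only [mongeAmpereDensity]
  rw [complexHessian_add hu contDiff_const, complexHessian_const, add_zero]

theorem IsMongeAmpere.tendsto_mollify {ν : Measure (Cn n)} (hν : IsMongeAmpere D u ν)
    (hu : IsContPSH D M u) (hD : IsOpen D) {f : Cn n → ℝ} (hf : Continuous f)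
    (hfc : HasCompactSupport f) (hfD : tsupport f ⊆ D) :
    Tendsto (fun i => ∫ p, f p * mongeAmpereDensity (mollify i (D.indicator u)) p)
      atTop (𝓝 (∫ p, f p ∂ν)) := by
  obtain ⟨L, hL⟩ := hu.exists_tendsto hD hf hfc hfD
  obtain ⟨V, hV, hKV, hVD, hVc⟩ := exists_open_between_and_isCompact_closure hfc.isCompact hD hfD
  obtain ⟨ψ, c, hψ, hpsh, anti, lim⟩ := exists_subseq_antitone_add_const
    (hu.tendstoUniformlyOn_mollify hD hVc hVD) (hu.eventually_isPSH_mollify hD hVc hVD)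
  have masses := hν.weak_limit V hV (subset_closure.trans hVD)
    (fun k z => mollify (ψ k) (D.indicator u) z + c k) (fun k => (hpsh k).add (isPSH_const _ _))
    (fun k => ((hu.contDiff_mollify hD _).add contDiff_const).contDiffOn) anti lim f hf hfc hKV
  simp only [mongeAmpereDensity_add_const (hu.contDiff_mollify hD _)] at masses
  rwa [tendsto_nhds_unique masses (hL.comp hψ)]

end WeakLimits

/-! ### Monge-Ampère measures -/

section VagueLimit

open scoped CompactlySupported

variable {X : Type*} [TopologicalSpace X] {D : Set X} {f : X → ℝ}

theorem extend_comp_subtype_val (hfD : tsupport f ⊆ D) :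
    Function.extend Subtype.val (fun x : D => f x) 0 = f := by
  funext x
  by_cases hx : x ∈ D
  · exact Subtype.val_injective.extend_apply (fun x : D => f x) (0 : X → ℝ) ⟨x, hx⟩
  · rw [Function.extend_apply' _ _ _ fun ⟨y, hy⟩ => hx (hy ▸ y.2), Pi.zero_apply,
      image_eq_zero_of_notMem_tsupport fun h => hx (hfD h)]

theorem hasCompactSupport_comp_subtype_val (hfc : HasCompactSupport f) (hfD : tsupport f ⊆ D) :
    HasCompactSupport fun x : D => f x :=
  .intro' (K := Subtype.val ⁻¹' tsupport f)
    (Topology.IsInducing.subtypeVal.isCompact_preimage_iff (by simpa using hfD) |>.2 hfc.isCompact)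
    ((isClosed_tsupport f).preimage continuous_subtype_val)
    fun _ hx => image_eq_zero_of_notMem_tsupport hx

variable [T2Space X]

theorem tsupport_extend_subset (f : C_c(D, ℝ)) : tsupport (Subtype.val.extend f 0) ⊆ D :=
  (f.hasCompactSupport.tsupport_extend_zero_subset continuous_subtype_val).trans
    (Subtype.coe_image_subset _ _)

variable [MeasurableSpace X] [BorelSpace X]

/-- The linear functional `f ↦ ∫ f φ dm` on compactly supported continuous functions on an open
set `D`, which are extended by zero. -/
noncomputable def densityFunctional (hD : IsOpen D) (m : Measure X) [IsFiniteMeasureOnCompacts m]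
    (φ : C(X, ℝ)) : C_c(D, ℝ) →ₗ[ℝ] ℝ where
  toFun f := ∫ x, Subtype.val.extend f 0 x * φ x ∂m
  map_add' f g := by
    have integrable : ∀ f : C_c(D, ℝ), Integrable (fun x => Subtype.val.extend f 0 x * φ x) m :=
      fun f => ((f.hasCompactSupport.continuous_extend_zero hD f.continuous).mul
        φ.continuous).integrable_of_hasCompactSupport
          (f.hasCompactSupport.extend_zero continuous_subtype_val).mul_right
    have extend_add := (Function.ExtendByZero.linearMap ℝ (Subtype.val : D → X)).map_add f g
    rw [← integral_add (integrable f) (integrable g)]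
    simp only [← add_mul]
    exact congr_arg (fun F => ∫ x, F x * φ x ∂m) extend_add
  map_smul' c f := by
    have extend_smul := (Function.ExtendByZero.linearMap ℝ (Subtype.val : D → X)).map_smul c f
    rw [RingHom.id_apply, smul_eq_mul, ← integral_const_mul]
    simp only [← mul_assoc]
    exact congr_arg (fun F => ∫ x, F x * φ x ∂m) extend_smul

theorem exists_measure_tendsto_integral [LocallyCompactSpace X] (hD : IsOpen D) {m : Measure X}
    [IsFiniteMeasureOnCompacts m] {ι : Type*} {l : Filter ι} [l.NeBot] (φ : ι → C(X, ℝ))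
    (lim : ∀ f : X → ℝ, Continuous f → HasCompactSupport f → tsupport f ⊆ D →
      ∃ L, Tendsto (fun i => ∫ x, f x * φ i x ∂m) l (𝓝 L))
    (nonneg : ∀ K : Set X, IsCompact K → K ⊆ D → ∀ᶠ i in l, ∀ x ∈ K, 0 ≤ φ i x) :
    ∃ ν : Measure X, (∀ K, IsCompact K → K ⊆ D → ν K < ⊤) ∧
      ∀ f : X → ℝ, Continuous f → HasCompactSupport f → tsupport f ⊆ D →
        Tendsto (fun i => ∫ x, f x * φ i x ∂m) l (𝓝 (∫ x, f x ∂ν)) := by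
  have : LocallyCompactSpace D := hD.locallyCompactSpace
  choose Λ hΛ using fun f : C_c(D, ℝ) => lim (Subtype.val.extend f 0)
    (f.hasCompactSupport.continuous_extend_zero hD f.continuous)
    (f.hasCompactSupport.extend_zero continuous_subtype_val) (tsupport_extend_subset f)
  have Λ_nonneg : ∀ f : C_c(D, ℝ), 0 ≤ f → 0 ≤ Λ f := fun f hf => by
    refine ge_of_tendsto (hΛ f) ?_
    filter_upwards [nonneg _ (f.hasCompactSupport.extend_zero continuous_subtype_val).isCompact
      (tsupport_extend_subset f)] with i hi
    refine integral_nonneg fun x => ?_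
    by_cases hx : x ∈ tsupport (Subtype.val.extend f 0)
    · exact mul_nonneg (Function.extend_nonneg hf le_rfl x) (hi x hx)
    · rw [image_eq_zero_of_notMem_tsupport hx, zero_mul, Pi.zero_apply]
  let P : C_c(D, ℝ) →ₚ[ℝ] ℝ := .mk₀
    (linearMapOfTendsto Λ (fun i => densityFunctional hD m (φ i)) (tendsto_pi_nhds.2 hΛ)) Λ_nonneg
  have embedding := MeasurableEmbedding.subtype_coe hD.measurableSet
  refine ⟨(RealRMK.rieszMeasure P).map Subtype.val, fun K hK hKD => ?_, fun f hf hfc hfD => ?_⟩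
  · rw [embedding.map_apply]
    exact (Topology.IsInducing.subtypeVal.isCompact_preimage_iff
      (by simpa using hKD) |>.2 hK).measure_lt_top
  · let F : C_c(D, ℝ) := ⟨⟨fun x => f x, hf.comp continuous_subtype_val⟩,
      hasCompactSupport_comp_subtype_val hfc hfD⟩
    have integral_eq : ∫ x, f x ∂(RealRMK.rieszMeasure P).map Subtype.val = Λ F := by
      rw [embedding.integral_map]
      exact RealRMK.integral_rieszMeasure P F
    have extend_F : Subtype.val.extend F 0 = f := extend_comp_subtype_val hfD
    rw [integral_eq]
    simpa only [extend_F] using hΛ F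

end VagueLimit

section MeasureComparison

variable {X : Type*} [TopologicalSpace X] [MeasurableSpace X] {ν ν' : Measure X}

theorem isFiniteMeasureOnCompacts_comap_subtype_val {D : Set X} (hD : MeasurableSet D)
    (hν : ∀ K, IsCompact K → K ⊆ D → ν K < ⊤) :
    IsFiniteMeasureOnCompacts (ν.comap (Subtype.val : D → X)) := by
  refine ⟨fun K hK => ?_⟩
  rw [(MeasurableEmbedding.subtype_coe hD).comap_apply]
  exact hν _ (hK.image continuous_subtype_val) (Subtype.coe_image_subset D K)

variable [BorelSpace X]

theorem measure_le_of_isOpen_of_integral_le [LocallyCompactSpace X] [T2Space X] [ν.Regular]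
    [IsFiniteMeasureOnCompacts ν']
    (h : ∀ f : X → ℝ, Continuous f → HasCompactSupport f → (∀ x, 0 ≤ f x) →
      ∫ x, f x ∂ν ≤ ∫ x, f x ∂ν') {O : Set X} (hO : IsOpen O) : ν O ≤ ν' O := by
  rw [hO.measure_eq_iSup_isCompact]
  refine iSup₂_le fun K hKO => iSup_le fun hK => ?_
  obtain ⟨χ, one_on_K, hχ, support_subset, hχ01⟩ :=
    exists_continuousMap_one_of_isCompact_subset_isOpen hK hO hKO
  have χ_nonneg : ∀ x, 0 ≤ χ x := fun x => (hχ01 x).1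
  calc ν K ≤ ∫⁻ x, ENNReal.ofReal (χ x) ∂ν := by
        rw [← lintegral_indicator_one hK.measurableSet]
        exact lintegral_mono (indicator_le fun x hx => by simp [one_on_K hx])
    _ = ENNReal.ofReal (∫ x, χ x ∂ν) := (ofReal_integral_eq_lintegral_ofReal
        (χ.continuous.integrable_of_hasCompactSupport hχ) (Eventually.of_forall χ_nonneg)).symm
    _ ≤ ENNReal.ofReal (∫ x, χ x ∂ν') := ENNReal.ofReal_le_ofReal (h χ χ.continuous hχ χ_nonneg)
    _ = ∫⁻ x, ENNReal.ofReal (χ x) ∂ν' := ofReal_integral_eq_lintegral_ofReal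
        (χ.continuous.integrable_of_hasCompactSupport hχ) (Eventually.of_forall χ_nonneg)
    _ ≤ ν' O := by
        rw [← lintegral_indicator_one hO.measurableSet]
        refine lintegral_mono fun x => ?_
        by_cases hx : x ∈ O
        · simpa [hx] using (hχ01 x).2
        · simp [image_eq_zero_of_notMem_tsupport fun h => hx (support_subset h)]

theorem measure_le_of_integral_le [LocallyCompactSpace X] [T2Space X] [ν.Regular] [ν'.Regular]
    (h : ∀ f : X → ℝ, Continuous f → HasCompactSupport f → (∀ x, 0 ≤ f x) →
      ∫ x, f x ∂ν ≤ ∫ x, f x ∂ν') : ν ≤ ν' := by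
  refine Measure.le_iff.2 fun A _ => ?_
  rw [A.measure_eq_iInf_isOpen ν']
  exact le_iInf₂ fun O hAO => le_iInf fun hO =>
    (measure_mono hAO).trans (measure_le_of_isOpen_of_integral_le h hO)

theorem restrict_le_restrict_of_integral_le [T2Space X] [LocallyCompactSpace X]
    [SecondCountableTopology X] {D : Set X} (hD : IsOpen D)
    (hν : ∀ K, IsCompact K → K ⊆ D → ν K < ⊤) (hν' : ∀ K, IsCompact K → K ⊆ D → ν' K < ⊤)
    (h : ∀ f : X → ℝ, Continuous f → HasCompactSupport f → tsupport f ⊆ D → (∀ x, 0 ≤ f x) →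
      ∫ x, f x ∂ν ≤ ∫ x, f x ∂ν') : ν.restrict D ≤ ν'.restrict D := by
  have : LocallyCompactSpace D := hD.locallyCompactSpace
  have := isFiniteMeasureOnCompacts_comap_subtype_val hD.measurableSet hν
  have := isFiniteMeasureOnCompacts_comap_subtype_val hD.measurableSet hν'
  rw [← map_comap_subtype_coe hD.measurableSet, ← map_comap_subtype_coe hD.measurableSet]
  refine Measure.map_mono (measure_le_of_integral_le fun f hf hfc hf0 => ?_) measurable_subtype_coe
  have support_subset := (hfc.tsupport_extend_zero_subset continuous_subtype_val).trans
    (Subtype.coe_image_subset D _)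
  have integral_comap : ∀ m : Measure X,
      ∫ x, f x ∂m.comap Subtype.val = ∫ x, Subtype.val.extend f 0 x ∂m := fun m => by
    rw [← setIntegral_eq_integral_of_forall_compl_eq_zero fun x hx =>
      image_eq_zero_of_notMem_tsupport fun hx' => hx (support_subset hx'),
      ← integral_subtype_comap hD.measurableSet]
    simp only [Subtype.val_injective.extend_apply]
  rw [integral_comap, integral_comap]
  refine h _ (hfc.continuous_extend_zero hD hf) (hfc.extend_zero continuous_subtype_val)
    support_subset (Function.extend_nonneg (Pi.le_def.2 hf0) le_rfl)

theorem restrict_union_le_restrict_union {X : Type*} [MeasurableSpace X] {ν ν' : Measure X}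
    {s t : Set X} (hs : MeasurableSet s) (h_s : ν.restrict s ≤ ν'.restrict s)
    (h_t : ν.restrict t ≤ ν'.restrict t) : ν.restrict (s ∪ t) ≤ ν'.restrict (s ∪ t) := by
  have restrict_union : ∀ m : Measure X,
      m.restrict (s ∪ t) = m.restrict s + (m.restrict t).restrict sᶜ := fun m => by
    rw [Measure.restrict_restrict hs.compl, ← sdiff_eq_compl_inter, ← union_sdiff_self]
    exact Measure.restrict_union' disjoint_sdiff_right hs
  rw [restrict_union, restrict_union]
  exact add_le_add h_s (Measure.restrict_mono_measure h_t _)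

theorem restrict_biUnion_finset_le {X ι : Type*} [MeasurableSpace X] {ν ν' : Measure X}
    (T : Finset ι) {s : ι → Set X} (hs : ∀ i ∈ T, MeasurableSet (s i))
    (h : ∀ i ∈ T, ν.restrict (s i) ≤ ν'.restrict (s i)) :
    ν.restrict (⋃ i ∈ T, s i) ≤ ν'.restrict (⋃ i ∈ T, s i) := by
  classical
  induction T using Finset.induction_on with
  | empty => simp
  | insert i T _ ih =>
    rw [Finset.set_biUnion_insert]
    exact restrict_union_le_restrict_union (hs i (Finset.mem_insert_self i T))
      (h i (Finset.mem_insert_self i T))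
      (ih (fun j hj => hs j (Finset.mem_insert_of_mem hj))
        fun j hj => h j (Finset.mem_insert_of_mem hj))

end MeasureComparison

section MongeAmpereMeasures

open scoped ComplexOrder

variable {n : ℕ} {D W : Set (Cn n)} {M : ℝ} {u : Cn n → ℝ} {ν : Measure (Cn n)}

theorem IsContPSH.exists_isMongeAmpere (hu : IsContPSH D M u) (hD : IsOpen D) :
    ∃ ν : Measure (Cn n), IsMongeAmpere D u ν := by
  obtain ⟨ν, finite, masses⟩ := exists_measure_tendsto_integral hD (m := volume) (l := atTop)
    (fun i => ⟨mongeAmpereDensity (mollify i (D.indicator u)),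
      continuous_mongeAmpereDensity (hu.contDiff_mollify hD i)⟩)
    (fun f hf hfc hfD => hu.exists_tendsto hD hf hfc hfD) fun K hK hKD => by
      obtain ⟨V, hV, hKV, hVD, hVc⟩ := exists_open_between_and_isCompact_closure hK hD hKD
      filter_upwards [hu.eventually_isSmoothPSH_mollify hD hV hVc hVD] with i hi p hp
      exact mongeAmpereDensity_nonneg (hi.posSemidef p (hKV hp))
  refine ⟨ν, finite, fun U hU hUD v hpsh hv anti lim f hf hfc hfU => ?_⟩
  -- Dini: a monotone limit of continuous functions with continuous limit is locally uniform.
  have uniform : TendstoLocallyUniformlyOn v u atTop U :=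
    Antitone.tendstoLocallyUniformlyOn_of_forall_tendsto (fun i => (hv i).continuousOn) anti
      (hu.continuousOn.mono hUD) lim
  exact hu.tendsto_of_tendstoLocallyUniformlyOn hD hf hfc hU hUD hpsh hv uniform hfU
    (masses f hf hfc (hfU.trans hUD))

theorem IsMongeAmpere.mono (h : IsMongeAmpere D u ν) (hWD : W ⊆ D) : IsMongeAmpere W u ν :=
  ⟨fun K hK hKW => h.finite_on_compacts K hK (hKW.trans hWD),
    fun U hU hUW => h.weak_limit U hU (hUW.trans hWD)⟩

theorem mongeAmpereDensity_le_add {v h : Cn n → ℝ} (hv : ContDiff ℝ ∞ v) (hh : ContDiff ℝ ∞ h)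
    {p : Cn n} (hvp : (complexHessian v p).PosSemidef) (hhp : (complexHessian h p).PosSemidef) :
    mongeAmpereDensity v p ≤ mongeAmpereDensity (fun x => v x + h x) p := by
  simp only [mongeAmpereDensity]
  rw [complexHessian_add hv hh]
  exact mul_le_mul_of_nonneg_left (Complex.le_def.1 (det_le_det_add hvp hhp)).1 (by positivity)

theorem IsMongeAmpere.integral_le_integral_add {M' M'' : ℝ} {h : Cn n → ℝ} {ν' : Measure (Cn n)}
    (hν : IsMongeAmpere W u ν) (hν' : IsMongeAmpere W (fun x => u x + h x) ν')
    (hu : IsContPSH W M u) (hh : IsContPSH W M' h) (huh : IsContPSH W M'' fun x => u x + h x)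
    (hW : IsOpen W) {f : Cn n → ℝ} (hf : Continuous f) (hfc : HasCompactSupport f)
    (hfW : tsupport f ⊆ W) (hf0 : ∀ p, 0 ≤ f p) : ∫ p, f p ∂ν ≤ ∫ p, f p ∂ν' := by
  refine le_of_tendsto_of_tendsto (hν.tendsto_mollify hu hW hf hfc hfW)
    (hν'.tendsto_mollify huh hW hf hfc hfW) ?_
  obtain ⟨V, hV, hKV, hVW, hVc⟩ := exists_open_between_and_isCompact_closure hfc.isCompact hW hfW
  filter_upwards [hu.eventually_isSmoothPSH_mollify hW hV hVc hVW,
    hh.eventually_isSmoothPSH_mollify hW hV hVc hVW] with i hui hhi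
  refine integral_mono (integrable_mul_mongeAmpereDensity hf hfc (hu.contDiff_mollify hW i))
    (integrable_mul_mongeAmpereDensity hf hfc (huh.contDiff_mollify hW i)) fun p => ?_
  by_cases hp : p ∈ tsupport f
  · have mollify_sum : mollify i (W.indicator fun x => u x + h x) =
        fun x => mollify i (W.indicator u) x + mollify i (W.indicator h) x := by
      rw [indicator_add]
      exact funext (mollify_add i (hu.measurable_indicator hW) hu.abs_indicator_le
        (hh.measurable_indicator hW) hh.abs_indicator_le)
    dsimp only
    rw [mollify_sum]
    exact mul_le_mul_of_nonneg_left (mongeAmpereDensity_le_add hui.contDiff hhi.contDiff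
      (hui.posSemidef p (hKV hp)) (hhi.posSemidef p (hKV hp))) (hf0 p)
  · simp only [image_eq_zero_of_notMem_tsupport hp, zero_mul, le_refl]

theorem IsMongeAmpere.restrict_le_restrict_add {M' M'' : ℝ} {h : Cn n → ℝ} {ν' : Measure (Cn n)}
    (hν : IsMongeAmpere W u ν) (hν' : IsMongeAmpere W (fun x => u x + h x) ν')
    (hu : IsContPSH W M u) (hh : IsContPSH W M' h) (huh : IsContPSH W M'' fun x => u x + h x)
    (hW : IsOpen W) : ν.restrict W ≤ ν'.restrict W :=
  restrict_le_restrict_of_integral_le hW hν.finite_on_compacts hν'.finite_on_compacts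
    fun _ hf hfc hfW hf0 => hν.integral_le_integral_add hν' hu hh huh hW hf hfc hfW hf0

end MongeAmpereMeasures

/-! ### Plurisubharmonicity is a local property -/

section CircleAverages

theorem circleAverage_comp_mul_left {E : Type*} [NormedAddCommGroup E] [NormedSpace ℝ E] {c : ℂ}
    (hc : ‖c‖ = 1) (f : ℂ → E) (a : ℂ) (R : ℝ) :
    Real.circleAverage (fun ζ => f (c * ζ)) a R = Real.circleAverage f (c * a) R := by
  have c_eq : Complex.exp (c.arg * Complex.I) = c := by
    simpa [hc] using Complex.norm_mul_exp_arg_mul_I c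
  have rotate : ∀ θ : ℝ, circleMap (c * a) R (θ + c.arg) = c * circleMap a R θ := fun θ => by
    simp only [circleMap, Complex.ofReal_add, add_mul, Complex.exp_add, c_eq]
    ring
  rw [Real.circleAverage_eq_integral_add (f := f) (c := c * a) c.arg, Real.circleAverage_def]
  simp only [rotate]

theorem circleAverage_norm_add_smul_sq {E : Type*} [NormedAddCommGroup E] [InnerProductSpace ℂ E]
    (x y : E) : Real.circleAverage (fun ζ : ℂ => ‖x + ζ • y‖ ^ 2) 0 1 = ‖x‖ ^ 2 + ‖y‖ ^ 2 := by
  have antipodal := circleAverage_comp_mul_left (c := -1) (by simp)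
    (fun ζ : ℂ => ‖x + ζ • y‖ ^ 2) 0 1
  have parallelogram : EqOn (fun ζ : ℂ => ‖x + ζ • y‖ ^ 2 + ‖x + (-1 * ζ) • y‖ ^ 2)
      (fun _ => 2 * (‖x‖ ^ 2 + ‖y‖ ^ 2)) (Metric.sphere 0 |1|) := fun ζ hζ => by
    have norm_ζ : ‖ζ‖ = 1 := by simpa using hζ
    have law := parallelogram_law_with_norm ℂ x (ζ • y)
    rw [norm_smul, norm_ζ, one_mul] at law
    simp only [neg_one_mul, neg_smul, ← sub_eq_add_neg]
    linarith
  have sum := Real.circleAverage_fun_add (c := 0) (R := 1)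
    (f₁ := fun ζ : ℂ => ‖x + ζ • y‖ ^ 2) (f₂ := fun ζ : ℂ => ‖x + (-1 * ζ) • y‖ ^ 2)
    (Continuous.continuousOn (by fun_prop) |>.circleIntegrable zero_le_one)
    (Continuous.continuousOn (by fun_prop) |>.circleIntegrable zero_le_one)
  rw [Real.circleAverage_congr_sphere parallelogram, Real.circleAverage_const, antipodal,
    mul_zero] at sum
  linarith

theorem circleAverage_norm_sq (c : ℂ) (R : ℝ) :
    Real.circleAverage (fun ζ : ℂ => ‖ζ‖ ^ 2) c R = ‖c‖ ^ 2 + R ^ 2 := by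
  rw [Real.circleAverage_eq_circleAverage_zero_one]
  simpa [mul_comm, add_comm] using circleAverage_norm_add_smul_sq c (R : ℂ)

theorem continuous_circleAverage_param {X : Type*} [TopologicalSpace X] {F : X → ℂ → ℝ}
    (hF : Continuous F.uncurry) (c : ℂ) (R : ℝ) :
    Continuous fun x => Real.circleAverage (F x) c R := by
  simp only [Real.circleAverage_def]
  have continuous_param : Continuous (Function.uncurry fun x θ => F x (circleMap c R θ)) :=
    hF.comp (continuous_fst.prodMk ((continuous_circleMap c R).comp continuous_snd))
  have continuous_integral : Continuous fun x => ∫ θ in 0..2 * Real.pi, F x (circleMap c R θ) :=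
    intervalIntegral.continuous_parametric_intervalIntegral_of_continuous' continuous_param _ _
  exact continuous_integral.const_smul (2 * Real.pi)⁻¹

theorem circleAverage_comm {F : ℂ → ℂ → ℝ} (hF : Continuous F.uncurry) (c d : ℂ) (R S : ℝ) :
    Real.circleAverage (fun x => Real.circleAverage (F x) d S) c R =
      Real.circleAverage (fun y => Real.circleAverage (fun x => F x y) c R) d S := by
  have continuous_param : Continuous fun q : ℝ × ℝ => F (circleMap c R q.1) (circleMap d S q.2) :=
    hF.comp (((continuous_circleMap c R).comp continuous_fst).prodMk
      ((continuous_circleMap d S).comp continuous_snd))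
  simp only [Real.circleAverage_def, intervalIntegral.integral_of_le Real.two_pi_pos.le,
    integral_smul]
  rw [integral_integral_swap]
  rw [Measure.prod_restrict]
  exact (continuous_param.continuousOn.integrableOn_compact
    (isCompact_Icc.prod isCompact_Icc)).mono_set
      (prod_mono Ioc_subset_Icc_self Ioc_subset_Icc_self)

end CircleAverages

section LocalSubMean

open scoped Pointwise

/-- The sub-mean value inequality for `g` on the circles of radius at most `s₀` which bound a disc
contained in the closed unit disc. -/
def IsLocallySubMean (s₀ : ℝ) (g : ℂ → ℝ) : Prop :=
  ∀ (ζ : ℂ) (s : ℝ), 0 < s → s ≤ s₀ → Metric.closedBall ζ s ⊆ Metric.closedBall 0 1 →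
    g ζ ≤ Real.circleAverage g ζ s

/-- The average of `g` over the rotations about the origin; it serves to turn the maximum principle
into the sub-mean value inequality at the origin. -/
noncomputable def rotationAverage (g : ℂ → ℝ) (ζ : ℂ) : ℝ :=
  Real.circleAverage (fun η => g (η * ζ)) 0 1

variable {g : ℂ → ℝ} {s₀ ε : ℝ}

theorem rotationAverage_zero (g : ℂ → ℝ) : rotationAverage g 0 = g 0 := by
  simp only [rotationAverage, mul_zero, Real.circleAverage_const]

theorem rotationAverage_of_norm_eq_one (g : ℂ → ℝ) {ζ : ℂ} (hζ : ‖ζ‖ = 1) :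
    rotationAverage g ζ = Real.circleAverage g 0 1 := by
  simp only [rotationAverage, mul_comm _ ζ, circleAverage_comp_mul_left hζ, mul_zero]

theorem continuous_rotationAverage (hg : Continuous g) : Continuous (rotationAverage g) :=
  continuous_circleAverage_param (F := fun ζ η => g (η * ζ))
    (hg.comp (continuous_snd.mul continuous_fst)) 0 1

theorem IsLocallySubMean.rotationAverage (h : IsLocallySubMean s₀ g) (hg : Continuous g) :
    IsLocallySubMean s₀ (rotationAverage g) := by
  intro ζ s hs hss₀ disc_subset
  have rotated_disc_subset : ∀ η : ℂ, ‖η‖ = 1 →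
      Metric.closedBall (η * ζ) s ⊆ Metric.closedBall 0 1 := fun η hη => by
    have hη₀ : η ≠ 0 := norm_ne_zero_iff.1 (hη ▸ one_ne_zero)
    have image_ball : η • Metric.closedBall ζ s = Metric.closedBall (η * ζ) s := by
      rw [smul_closedBall' hη₀, hη, one_mul, smul_eq_mul]
    have image_disc : η • Metric.closedBall (0 : ℂ) 1 = Metric.closedBall 0 1 := by
      rw [smul_closedBall' hη₀, hη, one_mul, smul_zero]
    rw [← image_ball, ← image_disc]
    exact smul_set_mono disc_subset
  have swap : Real.circleAverage (_root_.rotationAverage g) ζ s =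
      Real.circleAverage (fun η => Real.circleAverage g (η * ζ) s) 0 1 := by
    refine (circleAverage_comm (F := fun ξ η => g (η * ξ))
      (hg.comp (continuous_snd.mul continuous_fst)) ζ 0 s 1).trans
      (Real.circleAverage_congr_sphere fun η hη => ?_)
    exact circleAverage_comp_mul_left (by simpa using hη) g ζ s
  rw [swap]
  refine Real.circleAverage_mono
    (Continuous.continuousOn (by fun_prop) |>.circleIntegrable zero_le_one)
    (Continuous.continuousOn ?_ |>.circleIntegrable zero_le_one) fun η hη => ?_
  · simp only [Real.circleAverage_eq_circleAverage_zero_one (R := s)]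
    exact continuous_circleAverage_param (F := fun η z => g (s * z + η * ζ))
      (by rw [Function.uncurry_def]; fun_prop) 0 1
  · exact h (η * ζ) s hs hss₀ (rotated_disc_subset η (by simpa using hη))

theorem lt_circleAverage_add_mul_norm_sq (hg : Continuous g) {ζ : ℂ} {s : ℝ} (hs : s ≠ 0)
    (h : g ζ ≤ Real.circleAverage g ζ s) (hε : 0 < ε) :
    g ζ + ε * ‖ζ‖ ^ 2 < Real.circleAverage (fun ξ => g ξ + ε * ‖ξ‖ ^ 2) ζ s := by
  have sum := Real.circleAverage_fun_add (c := ζ) (R := s) (f₁ := g)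
    (f₂ := fun ξ : ℂ => ε • ‖ξ‖ ^ 2) hg.continuousOn.circleIntegrable'
    (Continuous.continuousOn (by fun_prop) |>.circleIntegrable')
  rw [Real.circleAverage_fun_smul, circleAverage_norm_sq] at sum
  simp only [smul_eq_mul] at sum
  rw [sum]
  nlinarith [mul_pos hε (pow_pos (abs_pos.2 hs) 2), sq_abs s]

theorem IsLocallySubMean.exists_norm_eq_one (h : IsLocallySubMean s₀ g) (hg : Continuous g)
    (hs₀ : 0 < s₀) (hε : 0 < ε) : ∃ ζ, ‖ζ‖ = 1 ∧ g 0 ≤ g ζ + ε := by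
  have continuous_perturbed : Continuous fun ξ : ℂ => g ξ + ε * ‖ξ‖ ^ 2 := by fun_prop
  obtain ⟨ζ, hζ, maximal⟩ := (isCompact_closedBall (0 : ℂ) 1).exists_isMaxOn ⟨0, by simp⟩
    continuous_perturbed.continuousOn
  rcases (mem_closedBall_zero_iff.1 hζ).eq_or_lt with norm_eq | norm_lt
  · have at_zero := maximal (Metric.mem_closedBall_self zero_le_one)
    simp only [mem_ofPred_eq, norm_zero, norm_eq] at at_zero
    exact ⟨ζ, norm_eq, by linarith⟩
  set s := min s₀ (1 - ‖ζ‖)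
  have s_pos : 0 < s := lt_min hs₀ (sub_pos.2 norm_lt)
  have disc_subset : Metric.closedBall ζ s ⊆ Metric.closedBall 0 1 :=
    Metric.closedBall_subset_closedBall' (by
      rw [dist_zero_right]
      linarith [min_le_right s₀ (1 - ‖ζ‖)])
  have average_le : Real.circleAverage (fun ξ => g ξ + ε * ‖ξ‖ ^ 2) ζ s ≤ g ζ + ε * ‖ζ‖ ^ 2 :=
    Real.circleAverage_mono_on_of_le_circle continuous_perturbed.continuousOn.circleIntegrable'
      fun ξ hξ => maximal (disc_subset (Metric.sphere_subset_closedBall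
        (by rwa [abs_of_pos s_pos] at hξ)))
  exact absurd average_le (lt_circleAverage_add_mul_norm_sq hg s_pos.ne'
    (h ζ s s_pos (min_le_left _ _) disc_subset) hε).not_ge

theorem IsLocallySubMean.le_circleAverage (h : IsLocallySubMean s₀ g) (hg : Continuous g)
    (hs₀ : 0 < s₀) : g 0 ≤ Real.circleAverage g 0 1 := by
  refine le_of_forall_pos_le_add fun ε hε => ?_
  obtain ⟨ζ, hζ, le⟩ :=
    (h.rotationAverage hg).exists_norm_eq_one (continuous_rotationAverage hg) hs₀ hε
  rwa [rotationAverage_zero, rotationAverage_of_norm_eq_one g hζ] at le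

end LocalSubMean

section Plurisubharmonic

variable {n : ℕ} {D : Set (Cn n)} {u v : Cn n → ℝ}

theorem circleIntegrable_comp_disc (hu : ContinuousOn u D) {a b : Cn n}
    (hab : ∀ ζ : ℂ, ‖ζ‖ ≤ 1 → a + ζ • b ∈ D) :
    CircleIntegrable (fun ζ : ℂ => u (a + ζ • b)) 0 1 :=
  (hu.comp (Continuous.continuousOn (by fun_prop)) fun ζ hζ =>
    hab ζ (mem_sphere_zero_iff_norm.1 hζ).le).circleIntegrable zero_le_one

theorem IsPSH.le_circleAverage (hu : IsPSH D u) {a b : Cn n} {ζ : ℂ} {s : ℝ} (hs : 0 ≤ s)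
    (hab : ∀ ξ ∈ Metric.closedBall ζ s, a + ξ • b ∈ D) :
    u (a + ζ • b) ≤ Real.circleAverage (fun ξ : ℂ => u (a + ξ • b)) ζ s := by
  have disc_eq : ∀ η : ℂ, a + (s * η + ζ) • b = a + ζ • b + η • (s : ℂ) • b := fun η => by
    module
  rw [Real.circleAverage_eq_circleAverage_zero_one]
  simp only [disc_eq]
  refine (hu.subMean _ _ fun η hη => disc_eq η ▸ hab _ ?_).2
  rw [Metric.mem_closedBall, dist_eq_norm, add_sub_cancel_right, norm_mul, Complex.norm_real,
    Real.norm_of_nonneg hs]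
  exact mul_le_of_le_one_right hs hη

theorem IsPSH.of_local (hu : ContinuousOn u D) (hloc : ∀ p ∈ D, ∃ W, IsOpen W ∧ p ∈ W ∧ IsPSH W u) :
    IsPSH D u := by
  refine ⟨hu.upperSemicontinuousOn, fun a b hab => ⟨circleIntegrable_comp_disc hu hab, ?_⟩⟩
  choose! W isOpen_W mem_W psh_W using hloc
  have disc_mem : ∀ ζ ∈ Metric.closedBall (0 : ℂ) 1, a + ζ • b ∈ D := fun ζ hζ =>
    hab ζ (mem_closedBall_zero_iff.1 hζ)
  have continuous_disc : Continuous fun ζ : ℂ => a + ζ • b := by fun_prop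
  obtain ⟨δ, δ_pos, lebesgue_number⟩ := lebesgue_number_lemma_of_metric
    (c := fun p : D => (fun ζ : ℂ => a + ζ • b) ⁻¹' W p) (isCompact_closedBall (0 : ℂ) 1)
    (fun p => (isOpen_W p p.2).preimage continuous_disc)
    fun ζ hζ => mem_iUnion.2 ⟨⟨_, disc_mem ζ hζ⟩, mem_W _ (disc_mem ζ hζ)⟩
  obtain ⟨g, restrict_g⟩ := ContinuousMap.exists_restrict_eq Metric.isClosed_closedBall
    ⟨_, (hu.comp continuous_disc.continuousOn disc_mem).domRestrict⟩
  have g_eq : ∀ ζ ∈ Metric.closedBall (0 : ℂ) 1, g ζ = u (a + ζ • b) := fun ζ hζ =>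
    DFunLike.congr_fun restrict_g ⟨ζ, hζ⟩
  have average_eq : ∀ {ζ s}, 0 ≤ s → Metric.closedBall ζ s ⊆ Metric.closedBall 0 1 →
      Real.circleAverage g ζ s = Real.circleAverage (fun ξ : ℂ => u (a + ξ • b)) ζ s :=
    fun {ζ s} hs disc_subset => Real.circleAverage_congr_sphere fun ξ hξ =>
      g_eq ξ (disc_subset (Metric.sphere_subset_closedBall (by rwa [abs_of_nonneg hs] at hξ)))
  have subMean : IsLocallySubMean (δ / 2) g := fun ζ s hs hsδ disc_subset => by
    have hζ := disc_subset (Metric.mem_closedBall_self hs.le)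
    obtain ⟨p, hp⟩ := lebesgue_number ζ hζ
    rw [g_eq ζ hζ, average_eq hs.le disc_subset]
    exact (psh_W p p.2).le_circleAverage hs.le fun ξ hξ =>
      hp (Metric.closedBall_subset_ball (by linarith) hξ)
  have at_center := subMean.le_circleAverage g.continuous (half_pos δ_pos)
  rwa [g_eq 0 (Metric.mem_closedBall_self zero_le_one), zero_smul, add_zero,
    average_eq zero_le_one subset_rfl] at at_center

theorem IsPSH.max (hu : IsPSH D u) (hv : IsPSH D v) (hcu : ContinuousOn u D)
    (hcv : ContinuousOn v D) : IsPSH D fun z => max (u z) (v z) := by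
  have continuousOn_max : ContinuousOn (fun z => Max.max (u z) (v z)) D := hcu.sup hcv
  refine ⟨continuousOn_max.upperSemicontinuousOn, fun a b hab => ?_⟩
  have integrable_max := circleIntegrable_comp_disc continuousOn_max hab
  obtain ⟨integrable_u, le_u⟩ := hu.subMean a b hab
  obtain ⟨integrable_v, le_v⟩ := hv.subMean a b hab
  exact ⟨integrable_max, max_le
    (le_u.trans (Real.circleAverage_mono integrable_u integrable_max fun _ _ => le_max_left _ _))
    (le_v.trans (Real.circleAverage_mono integrable_v integrable_max fun _ _ => le_max_right _ _))⟩

theorem IsPSH.sum {ι : Type*} (s : Finset ι) {u : ι → Cn n → ℝ} (hu : ∀ i ∈ s, IsPSH D (u i)) :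
    IsPSH D fun z => ∑ i ∈ s, u i z := by
  classical
  induction s using Finset.induction_on with
  | empty => simpa only [Finset.sum_empty] using isPSH_const D 0
  | insert i s hi ih =>
    simp only [Finset.sum_insert hi]
    exact (hu i (Finset.mem_insert_self i s)).add
      (ih fun j hj => hu j (Finset.mem_insert_of_mem hj))

theorem isPSH_quadratic (D : Set (Cn n)) (c : Cn n) {A : ℝ} (hA : 0 ≤ A) (s : ℝ) :
    IsPSH D fun z => A * (dist z c ^ 2 - s) := by
  have continuous_quadratic : Continuous fun z : Cn n => A * (dist z c ^ 2 - s) := by fun_prop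
  refine ⟨continuous_quadratic.upperSemicontinuous.upperSemicontinuousOn _, fun a b hab =>
    ⟨circleIntegrable_comp_disc continuous_quadratic.continuousOn hab, ?_⟩⟩
  have on_disc : (fun ζ : ℂ => A * (dist (a + ζ • b) c ^ 2 - s)) =
      fun ζ : ℂ => A • ‖(a - c) + ζ • b‖ ^ 2 + -(A * s) := by
    funext ζ
    rw [smul_eq_mul, dist_eq_norm, add_sub_right_comm]
    ring
  have integrable : CircleIntegrable (fun ζ : ℂ => A • ‖(a - c) + ζ • b‖ ^ 2) 0 1 :=
    Continuous.continuousOn (by fun_prop) |>.circleIntegrable zero_le_one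
  rw [on_disc, Real.circleAverage_fun_add integrable (circleIntegrable_const _ 0 1),
    Real.circleAverage_const, Real.circleAverage_fun_smul, circleAverage_norm_add_smul_sq,
    smul_eq_mul, dist_eq_norm]
  nlinarith [mul_nonneg hA (sq_nonneg ‖b‖)]

end Plurisubharmonic

/-! ### Hölder continuous functions on bounded sets -/

section Holder

variable {n : ℕ} {S S₁ S₂ : Set (Cn n)} {u v : Cn n → ℝ}

theorem IsHolderOn.mono (hu : IsHolderOn S₂ u) (h : S₁ ⊆ S₂) : IsHolderOn S₁ u := by
  obtain ⟨C, α, hα, hα₁, holder⟩ := hu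
  exact ⟨C, α, hα, hα₁, holder.mono h⟩

theorem IsHolderOn.congr (hu : IsHolderOn S u) (huv : EqOn u v S) : IsHolderOn S v := by
  obtain ⟨C, α, hα, hα₁, holder⟩ := hu
  exact ⟨C, α, hα, hα₁, fun x hx y hy => by
    rw [← huv hx, ← huv hy]
    exact holder x hx y hy⟩

theorem IsHolderOn.continuousOn (hu : IsHolderOn S u) : ContinuousOn u S := by
  obtain ⟨C, α, hα, -, holder⟩ := hu
  exact holder.continuousOn hα

theorem IsHolderOn.exists_abs_le (hu : IsHolderOn S u) (hS : Bornology.IsBounded S) :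
    ∃ M, 0 ≤ M ∧ ∀ x ∈ S, |u x| ≤ M := by
  obtain ⟨C, α, -, -, holder⟩ := hu
  have image_bounded : Bornology.IsBounded (u '' S) := Metric.isBounded_iff_ediam_ne_top.2
    (holder.ediam_image_le.trans_lt (ENNReal.mul_lt_top ENNReal.coe_lt_top
      (ENNReal.rpow_lt_top_of_nonneg α.2 hS.ediam_ne_top))).ne
  obtain ⟨M, hM⟩ := image_bounded.exists_norm_le
  exact ⟨max M 0, le_max_right _ _, fun x hx =>
    (hM _ (mem_image_of_mem u hx)).trans (le_max_left _ _)⟩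

theorem IsHolderOn.exists_common_exponent (hS₁ : Bornology.IsBounded S₁)
    (hS₂ : Bornology.IsBounded S₂) (hu : IsHolderOn S₁ u) (hv : IsHolderOn S₂ v) :
    ∃ C α : ℝ≥0, 0 < α ∧ α ≤ 1 ∧ HolderOnWith C α u S₁ ∧ HolderOnWith C α v S₂ := by
  obtain ⟨C₁, α₁, hα₁, hα₁', holder_u⟩ := hu
  obtain ⟨C₂, α₂, hα₂, -, holder_v⟩ := hv
  obtain ⟨C₁', holder_u'⟩ := HolderOnWith.exists_holderOnWith_of_le ⟨C₁, holder_u⟩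
    (min_le_left α₁ α₂) hS₁
  obtain ⟨C₂', holder_v'⟩ := HolderOnWith.exists_holderOnWith_of_le ⟨C₂, holder_v⟩
    (min_le_right α₁ α₂) hS₂
  exact ⟨max C₁' C₂', min α₁ α₂, lt_min hα₁ hα₂, (min_le_left _ _).trans hα₁',
    holder_u'.mono_const (le_max_left _ _), holder_v'.mono_const (le_max_right _ _)⟩

theorem IsHolderOn.comp_lipschitzWith (hS : Bornology.IsBounded S) (hu : IsHolderOn S u)
    (hv : IsHolderOn S v) {K : ℝ≥0} {φ : ℝ × ℝ → ℝ} (hφ : LipschitzWith K φ) :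
    IsHolderOn S fun x => φ (u x, v x) := by
  obtain ⟨C, α, hα, hα₁, holder_u, holder_v⟩ := hu.exists_common_exponent hS hS hv
  have holder_prod : HolderOnWith C α (fun x => (u x, v x)) S := fun x hx y hy =>
    max_le (holder_u x hx y hy) (holder_v x hx y hy)
  have holder_comp := (holderWith_one.2 hφ).comp_holderOnWith holder_prod
  rw [one_mul] at holder_comp
  exact ⟨_, α, hα, hα₁, holder_comp⟩

theorem IsHolderOn.add (hS : Bornology.IsBounded S) (hu : IsHolderOn S u) (hv : IsHolderOn S v) :
    IsHolderOn S fun x => u x + v x :=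
  hu.comp_lipschitzWith hS hv (LipschitzWith.prod_fst.add LipschitzWith.prod_snd)

theorem IsHolderOn.max (hS : Bornology.IsBounded S) (hu : IsHolderOn S u) (hv : IsHolderOn S v) :
    IsHolderOn S fun x => max (u x) (v x) :=
  hu.comp_lipschitzWith hS hv lipschitzWith_max

theorem isHolderOn_of_contDiff (hS : Bornology.IsBounded S) (hu : ContDiff ℝ 1 u) :
    IsHolderOn S u := by
  obtain ⟨K, lipschitz⟩ := hu.locallyLipschitz.locallyLipschitzOn.exists_lipschitzOnWith_of_compact
    hS.isCompact_closure
  exact ⟨K, 1, one_pos, le_rfl, holderOnWith_one.2 (lipschitz.mono subset_closure)⟩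

theorem IsHolderOn.sum {ι : Type*} (hS : Bornology.IsBounded S) (s : Finset ι)
    {u : ι → Cn n → ℝ} (hu : ∀ i ∈ s, IsHolderOn S (u i)) :
    IsHolderOn S fun x => ∑ i ∈ s, u i x := by
  classical
  induction s using Finset.induction_on with
  | empty => simpa only [Finset.sum_empty] using isHolderOn_of_contDiff hS contDiff_const
  | insert i s hi ih =>
    simp only [Finset.sum_insert hi]
    exact (hu i (Finset.mem_insert_self i s)).add hS
      (ih fun j hj => hu j (Finset.mem_insert_of_mem hj))

theorem isHolderOn_of_dist_lt {C α : ℝ≥0} (hα : 0 < α) (hα₁ : α ≤ 1) {M δ : ℝ} (hM : 0 ≤ M)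
    (hδ : 0 < δ) (bound : ∀ x ∈ S, |u x| ≤ M)
    (small_scale : ∀ x ∈ S, ∀ y ∈ S, dist x y < δ → dist (u x) (u y) ≤ C * dist x y ^ (α : ℝ)) :
    IsHolderOn S u := by
  lift M to ℝ≥0 using hM
  lift δ to ℝ≥0 using hδ.le
  refine ⟨C + 2 * M / δ ^ (α : ℝ), α, hα, hα₁, fun x hx y hy => ?_⟩
  rw [edist_nndist, edist_nndist, ← ENNReal.coe_rpow_of_nonneg _ α.coe_nonneg, ← ENNReal.coe_mul,
    ENNReal.coe_le_coe, add_mul]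
  rcases lt_or_ge (dist x y) δ with near | far
  · exact (small_scale x hx y hy near : nndist _ _ ≤ C * nndist x y ^ (α : ℝ)).trans le_self_add
  · have pow_le : δ ^ (α : ℝ) ≤ nndist x y ^ (α : ℝ) := NNReal.rpow_le_rpow far α.coe_nonneg
    have diameter : nndist (u x) (u y) ≤ 2 * M := by
      rw [← NNReal.coe_le_coe, coe_nndist, Real.dist_eq, NNReal.coe_mul, NNReal.coe_ofNat]
      linarith [abs_sub (u x) (u y), bound x hx, bound y hy]
    refine (diameter.trans ?_).trans le_add_self
    rw [div_mul_eq_mul_div, le_div_iff₀ (NNReal.rpow_pos hδ)]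
    gcongr

theorem IsHolderOn.union (hS₁ : Bornology.IsBounded S₁) (hS₂ : Bornology.IsBounded S₂)
    (h₁ : IsHolderOn S₁ u) (h₂ : IsHolderOn S₂ u) {δ : ℝ} (hδ : 0 < δ)
    (close : ∀ x ∈ S₁ ∪ S₂, ∀ y ∈ S₁ ∪ S₂, dist x y < δ →
      x ∈ S₁ ∧ y ∈ S₁ ∨ x ∈ S₂ ∧ y ∈ S₂) : IsHolderOn (S₁ ∪ S₂) u := by
  obtain ⟨M₁, hM₁, bound₁⟩ := h₁.exists_abs_le hS₁
  obtain ⟨M₂, -, bound₂⟩ := h₂.exists_abs_le hS₂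
  obtain ⟨C, α, hα, hα₁, holder₁, holder₂⟩ := h₁.exists_common_exponent hS₁ hS₂ h₂
  refine isHolderOn_of_dist_lt (C := C) hα hα₁ (le_max_of_le_left hM₁ : 0 ≤ Max.max M₁ M₂) hδ
    (fun x hx => ?_) fun x hx y hy hxy => ?_
  · exact hx.elim (fun hx => le_max_of_le_left (bound₁ x hx))
      fun hx => le_max_of_le_right (bound₂ x hx)
  · rcases close x hx y hy hxy with ⟨hx, hy⟩ | ⟨hx, hy⟩
    · exact holder₁.dist_le hx hy
    · exact holder₂.dist_le hx hy

theorem IsHolderOn.exists_isContPSH (hu : IsHolderOn S u) (hS : Bornology.IsBounded S)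
    (hpsh : IsPSH S u) : ∃ M, IsContPSH S M u := by
  obtain ⟨M, hM, bound⟩ := hu.exists_abs_le hS
  exact ⟨M, hu.continuousOn, hpsh, hM, bound⟩

end Holder

/-! ### Gluing a local function with a quadratic one -/

section Gluing

variable {n : ℕ} {Ω S : Set (Cn n)} {z : Cn n} {r ρ : ℝ} {w q : Cn n → ℝ}

open scoped Classical in
/-- The function equal to `max w q` in the ball of radius `r` about `z` and to `q` elsewhere. It
inherits the regularity of `w` and `q` when `w ≤ q` near the boundary of the ball. -/
noncomputable def glue (z : Cn n) (r : ℝ) (w q : Cn n → ℝ) (x : Cn n) : ℝ :=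
  if x ∈ Metric.ball z r then max (w x) (q x) else q x

theorem glue_of_mem_ball {x : Cn n} (hx : x ∈ Metric.ball z r) :
    glue z r w q x = max (w x) (q x) :=
  if_pos hx

theorem glue_eqOn_sdiff_closedBall
    (hwq : ∀ x ∈ S ∩ Metric.ball z r, x ∉ Metric.closedBall z ρ → w x ≤ q x) :
    EqOn (glue z r w q) q (S \ Metric.closedBall z ρ) := fun x hx => by
  by_cases hxr : x ∈ Metric.ball z r
  · rw [glue_of_mem_ball hxr, max_eq_right (hwq x ⟨hx.1, hxr⟩ hx.2)]
  · exact if_neg hxr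

theorem inter_ball_union_sdiff_closedBall (S : Set (Cn n)) (z : Cn n) (hρr : ρ < r) :
    S ∩ Metric.ball z r ∪ S \ Metric.closedBall z ρ = S := by
  rw [sdiff_eq, ← inter_union_distrib_left, inter_eq_left]
  exact fun x _ => (em (x ∈ Metric.closedBall z ρ)).imp_left
    fun hx => Metric.closedBall_subset_ball hρr hx

theorem IsHolderOn.glue (hS : Bornology.IsBounded S) (hρr : ρ < r)
    (hw : IsHolderOn (S ∩ Metric.ball z r) w) (hq : IsHolderOn S q)
    (hwq : ∀ x ∈ S ∩ Metric.ball z r, x ∉ Metric.closedBall z ρ → w x ≤ q x) :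
    IsHolderOn S (glue z r w q) := by
  have inside_bounded := hS.subset (inter_subset_left (t := Metric.ball z r))
  have inside := (hw.max inside_bounded (hq.mono inter_subset_left)).congr
    fun x hx => (glue_of_mem_ball hx.2).symm
  have outside := (hq.mono sdiff_subset).congr (glue_eqOn_sdiff_closedBall hwq).symm
  have union := inside.union inside_bounded (hS.subset sdiff_subset) outside
    (sub_pos.2 hρr) fun x hx y hy hxy => ?_
  · rwa [inter_ball_union_sdiff_closedBall S z hρr] at union
  rw [inter_ball_union_sdiff_closedBall S z hρr] at hx hy
  have mem_ball_of_near : ∀ {a b}, a ∈ Metric.closedBall z ρ → dist a b < r - ρ →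
      a ∈ Metric.ball z r ∧ b ∈ Metric.ball z r := fun {a b} ha hab =>
    ⟨Metric.closedBall_subset_ball hρr ha,
      (dist_triangle_left b z a).trans_lt (by linarith [Metric.mem_closedBall.1 ha])⟩
  by_cases hxρ : x ∈ Metric.closedBall z ρ
  · obtain ⟨hxr, hyr⟩ := mem_ball_of_near hxρ hxy
    exact Or.inl ⟨⟨hx, hxr⟩, hy, hyr⟩
  by_cases hyρ : y ∈ Metric.closedBall z ρ
  · obtain ⟨hyr, hxr⟩ := mem_ball_of_near hyρ (dist_comm x y ▸ hxy)
    exact Or.inl ⟨⟨hx, hxr⟩, hy, hyr⟩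
  · exact Or.inr ⟨⟨hx, hxρ⟩, hy, hyρ⟩

theorem IsPSH.glue (hΩ : IsOpen Ω) (hρr : ρ < r) (hwc : ContinuousOn w (Ω ∩ Metric.ball z r))
    (hw : IsPSH (Ω ∩ Metric.ball z r) w) (hqc : ContinuousOn q Ω) (hq : IsPSH Ω q)
    (hwq : ∀ x ∈ Ω ∩ Metric.ball z r, x ∉ Metric.closedBall z ρ → w x ≤ q x) :
    IsPSH Ω (glue z r w q) := by
  have inside : EqOn (fun x => Max.max (w x) (q x)) (_root_.glue z r w q) (Ω ∩ Metric.ball z r) :=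
    fun x hx => (glue_of_mem_ball hx.2).symm
  have outside := (glue_eqOn_sdiff_closedBall hwq).symm
  have inside_psh := (hw.max (hq.mono inter_subset_left) hwc (hqc.mono inter_subset_left)).congr
    inside
  have outside_psh := (hq.mono sdiff_subset).congr outside
  have inside_cont := (hwc.sup (hqc.mono inter_subset_left)).congr inside.symm
  have outside_cont := (hqc.mono sdiff_subset).congr outside.symm
  have inside_open := hΩ.inter (Metric.isOpen_ball (x := z) (ε := r))
  have outside_open := hΩ.sdiff (Metric.isClosed_closedBall (x := z) (ε := ρ))
  have cover := inter_ball_union_sdiff_closedBall Ω z hρr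
  refine IsPSH.of_local ?_ fun p hp => ?_
  · rw [← cover]
    exact inside_cont.union_of_isOpen outside_cont inside_open outside_open
  · rw [← cover] at hp
    exact hp.elim (fun hp => ⟨_, inside_open, hp, inside_psh⟩)
      fun hp => ⟨_, outside_open, hp, outside_psh⟩

theorem exists_isPSH_quadratic (z : Cn n) (hr : 0 < r) {M : ℝ} (hM : 0 ≤ M) :
    ∃ q : Cn n → ℝ, ContDiff ℝ 1 q ∧ (∀ D, IsPSH D q) ∧
      (∀ x ∈ Metric.ball z (r / 3), q x ≤ -M) ∧
      ∀ x, x ∉ Metric.closedBall z (2 * r / 3) → M ≤ q x := by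
  set A := 6 * M / r ^ 2 with hA
  have A_nonneg : 0 ≤ A := by positivity
  have inner_value : A * ((r / 3) ^ 2 - 5 / 18 * r ^ 2) = -M := by
    rw [hA]
    field_simp
    ring
  have outer_value : A * ((2 * r / 3) ^ 2 - 5 / 18 * r ^ 2) = M := by
    rw [hA]
    field_simp
    ring
  refine ⟨fun x => A * (dist x z ^ 2 - 5 / 18 * r ^ 2), ?_,
    fun D => isPSH_quadratic D z A_nonneg _, fun x hx => ?_, fun x hx => ?_⟩
  · simp only [dist_eq_norm]
    exact contDiff_const.mul (((contDiff_id.sub contDiff_const).norm_sq ℝ).sub contDiff_const)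
  · rw [← inner_value]
    have dist_le : dist x z ≤ r / 3 := (Metric.mem_ball.1 hx).le
    beta_reduce
    gcongr
  · rw [← outer_value]
    have le_dist : 2 * r / 3 ≤ dist x z := (not_le.1 hx).le
    beta_reduce
    gcongr

theorem exists_eqOn_ball_of_isPSH (hΩ : IsOpen Ω) (hbdd : Bornology.IsBounded Ω) (hr : 0 < r)
    (hw : IsHolderOn (closure (Ω ∩ Metric.ball z r)) w) (hpsh : IsPSH (Ω ∩ Metric.ball z r) w) :
    ∃ g, IsHolderOn (closure Ω) g ∧ IsPSH Ω g ∧ EqOn g w (Ω ∩ Metric.ball z (r / 3)) := by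
  obtain ⟨M, hM, bound⟩ := hw.exists_abs_le (hbdd.subset inter_subset_left).closure
  obtain ⟨q, q_smooth, q_psh, q_le, le_q⟩ := exists_isPSH_quadratic z hr hM
  have closure_inter : closure Ω ∩ Metric.ball z r ⊆ closure (Ω ∩ Metric.ball z r) :=
    Metric.isOpen_ball.closure_inter
  have w_le_q : ∀ x ∈ closure Ω ∩ Metric.ball z r, x ∉ Metric.closedBall z (2 * r / 3) →
      w x ≤ q x := fun x hx hxz =>
    (le_abs_self _).trans ((bound x (closure_inter hx)).trans (le_q x hxz))
  refine ⟨glue z r w q, (hw.mono closure_inter).glue hbdd.closure (by linarith)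
    (isHolderOn_of_contDiff hbdd.closure q_smooth) w_le_q, ?_, fun x hx => ?_⟩
  · exact hpsh.glue hΩ (by linarith) (hw.continuousOn.mono subset_closure)
      q_smooth.continuous.continuousOn (q_psh Ω)
      fun x hx => w_le_q x (inter_subset_inter_left _ subset_closure hx)
  · have hxr : x ∈ Metric.ball z r := Metric.ball_subset_ball (by linarith) hx.2
    rw [glue_of_mem_ball hxr, max_eq_left]
    exact (q_le x hx.2).trans (neg_le_of_abs_le (bound x (subset_closure ⟨hx.1, hxr⟩)))

end Gluing

/-! ### Local solvability implies global solvability -/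

section Globalization

variable {n : ℕ} {D W Ω : Set (Cn n)} {u v : Cn n → ℝ} {μ ν : Measure (Cn n)}

theorem IsMongeAmpere.congr (hν : IsMongeAmpere D u ν) (huv : EqOn u v D) : IsMongeAmpere D v ν :=
  ⟨hν.finite_on_compacts, fun U hU hUD w hpsh hw anti lim =>
    hν.weak_limit U hU hUD w hpsh hw anti fun z hz => (huv (hUD hz)).symm ▸ lim z hz⟩

theorem MongeAmpereGE.mono (hu : MongeAmpereGE D u μ) (hWD : W ⊆ D) : MongeAmpereGE W u μ := by
  obtain ⟨ν, hν, hμν⟩ := hu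
  have restricted := Measure.restrict_mono_measure hμν W
  rw [Measure.restrict_restrict_of_subset hWD, Measure.restrict_restrict_of_subset hWD]
    at restricted
  exact ⟨ν, hν.mono hWD, restricted⟩

theorem MongeAmpereGE.congr (hu : MongeAmpereGE D u μ) (huv : EqOn u v D) :
    MongeAmpereGE D v μ := by
  obtain ⟨ν, hν, hμν⟩ := hu
  exact ⟨ν, hν.congr huv, hμν⟩

theorem IsHolderOn.mongeAmpereGE_sum {ι : Type*} {T : Finset ι} {g : ι → Cn n → ℝ}
    {W : ι → Set (Cn n)} (hΩ : IsOpen Ω) (hbdd : Bornology.IsBounded Ω)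
    (hg : ∀ i ∈ T, IsHolderOn Ω (g i)) (hpsh : ∀ i ∈ T, IsPSH Ω (g i))
    (hW : ∀ i ∈ T, IsOpen (W i)) (hcover : ⋃ i ∈ T, W i = Ω)
    (hge : ∀ i ∈ T, MongeAmpereGE (W i) (g i) μ) :
    MongeAmpereGE Ω (fun x => ∑ i ∈ T, g i x) μ := by
  classical
  have contPSH : ∀ S ⊆ T, ∃ M, IsContPSH Ω M fun x => ∑ i ∈ S, g i x := fun S hS =>
    (IsHolderOn.sum hbdd S fun i hi => hg i (hS hi)).exists_isContPSH hbdd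
      (IsPSH.sum S fun i hi => hpsh i (hS hi))
  obtain ⟨M, contPSH_sum⟩ := contPSH T subset_rfl
  obtain ⟨ν', hν'⟩ := contPSH_sum.exists_isMongeAmpere hΩ
  refine ⟨ν', hν', hcover ▸ restrict_biUnion_finset_le T (fun i hi => (hW i hi).measurableSet)
    fun i hi => ?_⟩
  have hWΩ : W i ⊆ Ω := hcover ▸ subset_biUnion_of_mem (u := W) hi
  obtain ⟨ν, hν, hμν⟩ := hge i hi
  obtain ⟨M₁, contPSH_term⟩ := (hg i hi).exists_isContPSH hbdd (hpsh i hi)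
  obtain ⟨M₂, contPSH_rest⟩ := contPSH (T.erase i) (T.erase_subset i)
  have split : (fun x => ∑ j ∈ T, g j x) = fun x => g i x + ∑ j ∈ T.erase i, g j x :=
    funext fun x => (Finset.add_sum_erase T (fun j => g j x) hi).symm
  rw [split] at contPSH_sum hν'
  exact hμν.trans (hν.restrict_le_restrict_add (hν'.mono hWΩ) (contPSH_term.mono hWΩ)
    (contPSH_rest.mono hWΩ) (contPSH_sum.mono hWΩ) (hW i hi))

end Globalization

theorem theorem1_general (n : ℕ) (Ω : Set (Cn n)) (hopen : IsOpen Ω)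
    (hbdd : Bornology.IsBounded Ω) (μ : Measure (Cn n))
    (hloc : ∀ z ∈ closure Ω, ∃ r : ℝ, 0 < r ∧ ∃ w : Cn n → ℝ,
      IsHolderOn (closure (Ω ∩ Metric.ball z r)) w ∧ IsPSH (Ω ∩ Metric.ball z r) w ∧
        MongeAmpereGE (Ω ∩ Metric.ball z r) w μ) :
    ∃ u : Cn n → ℝ, IsHolderOn (closure Ω) u ∧ IsPSH Ω u ∧ MongeAmpereGE Ω u μ := by
  have hext : ∀ z ∈ closure Ω, ∃ ρ : ℝ, 0 < ρ ∧ ∃ g : Cn n → ℝ, IsHolderOn (closure Ω) g ∧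
      IsPSH Ω g ∧ MongeAmpereGE (Ω ∩ Metric.ball z ρ) g μ := fun z hz => by
    obtain ⟨r, hr, w, hw, hpsh, hge⟩ := hloc z hz
    obtain ⟨g, hg, hgpsh, hgw⟩ := exists_eqOn_ball_of_isPSH hopen hbdd hr hw hpsh
    have smaller : Ω ∩ Metric.ball z (r / 3) ⊆ Ω ∩ Metric.ball z r :=
      inter_subset_inter_right _ (Metric.ball_subset_ball (by linarith))
    exact ⟨r / 3, by positivity, g, hg, hgpsh, (hge.mono smaller).congr hgw.symm⟩
  choose! ρ hρ g hg hpsh hge using hext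
  obtain ⟨T, hT, hcover⟩ := hbdd.isCompact_closure.elim_nhds_subcover
    (fun z => Metric.ball z (ρ z)) fun z hz => Metric.ball_mem_nhds z (hρ z hz)
  refine ⟨fun x => ∑ z ∈ T, g z x, IsHolderOn.sum hbdd.closure T fun z hz => hg z (hT z hz),
    IsPSH.sum T fun z hz => hpsh z (hT z hz), ?_⟩
  refine IsHolderOn.mongeAmpereGE_sum hopen hbdd
    (fun z hz => (hg z (hT z hz)).mono subset_closure) (fun z hz => hpsh z (hT z hz))
    (fun z _ => hopen.inter Metric.isOpen_ball) ?_ fun z hz => hge z (hT z hz)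
  rw [← inter_iUnion₂, inter_eq_left]
  exact subset_closure.trans hcover

/-- `μ` is a Borel measure on `ℂⁿ` of which only the restriction to `Ω` is used. -/
theorem theorem1 (n : ℕ) (Ω : Set (Cn n)) (hopen : IsOpen Ω) (hconn : IsConnected Ω)
    (hbdd : Bornology.IsBounded Ω) (μ : Measure (Cn n))
    (hloc : ∀ z ∈ closure Ω, ∃ r : ℝ, 0 < r ∧ ∃ w : Cn n → ℝ,
      IsSubsolution (Ω ∩ Metric.ball z r) μ w ∧ ∀ p ∈ Ω ∩ Metric.ball z r, w p < 0) :
    ∃ u : Cn n → ℝ, IsHolderOn (closure Ω) u ∧ IsPSH Ω u ∧ MongeAmpereGE Ω u μ :=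
  theorem1_general n Ω hopen hbdd μ fun z hz =>
    let ⟨r, hr, w, ⟨ν, hμν, hw⟩, _⟩ := hloc z hz
    ⟨r, hr, w, hw.holder, hw.psh, ν, hw.mongeAmpere, hμν⟩
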